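/- **Setting.** Let $\omega>0$ and let $f:\mathbb R\to\mathbb R$ be continuous and periodic with period $2\pi/\omega$. Write $M(h)=\lim_{T\to\infty}\frac1{2T}\int_{-T}^{T}h(t)\,dt$ for the mean value, $\langle m\rangle=|m|$ for $m\in\mathbb Z\setminus\{0\}$, $\langle 0\rangle=1$, and $$q(t)=e^{i\int_0^tf},\quad \mathcal Q_0=q^2,\quad \mathcal Q_1(t)=\mathcal Q_0(t)\int_0^t\big(\mathcal Q_0^{-1}-M(\mathcal Q_0^{-1})\big),$$ $$\mathcal Q_2(t)=\mathcal Q_0(t)\int_0^t\big(\mathcal Q_0-M(\mathcal Q_0)\big),\quad \mathcal Q_3(t)=\mathcal Q_0(t)\int_0^t\big(\mathcal Q_1-M(\mathcal Q_1)\big).$$ For functions $a_1,\dots,a_n$ put $[a_1]=a_1$ and $[a_1|\cdots|a_n](t)=a_1(t)\int_0^t\big([a_2|\cdots|a_n](\tau)-M([a_2|\cdots|a_n])\big)d\tau$; inside these brackets $0,1,2$ abbreviate $\mathcal Q_0,\mathcal Q_1,\mathcal Q_2$. For constants $\kappa_n\in\mathbb C$, $n\ge1$, define $$v_1=\kappa_1q,\quad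 v_2(t)=q(t)\Big[i\int_0^t(\kappa_1^2\mathcal Q_0-\mathcal Q_0^{-1})d\tau+\kappa_2\Big],\quad v_n(t)=q(t)\Big[i\int_0^t\sum_{p=1}^{n-1}v_pv_{n-p}\,d\tau+\kappa_n\Big]\ (n\ge3),$$ and $l_m(t)=i\,q(t)^2\int_0^t\sum_{p=1}^{m-1}v_pv_{m-p}\,d\tau$. **Choice of the constants.** Assume condition (III): $M(\mathcal Q_0)=M(\mathcal Q_1)=0$ and $\mu:=M(\mathcal Q_3)\ne0$. The constants $\kappa_n$ that eliminate the secular terms are given recursively by $$\kappa_1^2=\frac{\overline{\mu}}{\mu}\ \text{(either root)},\qquad \kappa_2=-\frac{i\,M(\mathcal A_1)}{2\mu},\qquad \kappa_3=\frac{4M(\mathcal A_4)-M(\mathcal A_3)-M(\mathcal A_2)}{4\kappa_1\mu},$$ $$\kappa_{n-3}=\frac{-1}{4\kappa_1\mu}\Big\{\sum_{p=4}^{n-4}M(v_pv_{n-p})+2\mathcal R^{(1)}_n+2\mathcal R^{(2)}_n+2M(q^{-1}v_3l_{n-3})\Big\}\qquad(n\ge7),$$ where, with $s=-\mathcal Q_0^{-1}(\kappa_1^2\mathcal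 Q_2-\mathcal Q_1)^2$, $$\mathcal A_1=-4\kappa_1^4[0|0|2]+4\kappa_1^2[0|0|1]+[0|s],$$ $$\mathcal A_2=8\kappa_1^6[0|2|2]-8\kappa_1^4[0|2|1]-8i\kappa_1^4\kappa_2[0|2|0]-8\kappa_1^4[0|1|2]+8\kappa_1^2[0|1|1]+8i\kappa_1^2\kappa_2[0|1|0]$$ $$\qquad+16i\kappa_1^2\kappa_2[0|0|1]-32i\kappa_1^4\kappa_2[0|0|2]-12\kappa_1^2\kappa_2^2[0|2]-4\kappa_1^2[0|\mathcal A_1],$$ $$\mathcal A_3=8\kappa_1^6[2|0|2]-8\kappa_1^4[2|0|1]-8i\kappa_1^4\kappa_2[2|0|0]-8\kappa_1^4[1|0|2]+8\kappa_1^2[1|0|1]+8i\kappa_1^2\kappa_2[1|0|0]$$ $$\qquad-8i\kappa_1^4\kappa_2[0|0|2]+8i\kappa_1^2\kappa_2[0|0|1]-8\kappa_1^2\kappa_2^2[0|0|0]-2\kappa_1^2[2|v_2^2]+2[1|v_2^2]+2i\kappa_2[0|v_2^2],$$ $$\mathcal A_4=\mathcal Q_0^{-1}\big(i\kappa_1^3[0|2]-i\kappa_1[0|1]+\kappa_1\kappa_2\mathcal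 Q_2\big)^2,$$ $$\mathcal R^{(1)}_n=2i\kappa_1\sum_{p=1}^{n-4}\Big\{-2\kappa_1^2M[0|0|0|v_pv_{n-3-p}]+M[0|1|v_pv_{n-3-p}]-\kappa_1^2M[0|2|v_pv_{n-3-p}]+i\kappa_2M[0|0|v_pv_{n-3-p}]\Big\}$$ $$\qquad-2\kappa_1^2\sum_{p=2}^{n-4}M[0|0|v_pv_{n-2-p}]+i\kappa_1\sum_{p=3}^{n-4}M[0|v_pv_{n-1-p}],$$ $$\mathcal R^{(2)}_n=-2\kappa_1\sum_{p=1}^{n-4}M[qv_2|0|v_pv_{n-3-p}]+i\sum_{p=2}^{n-4}M[qv_2|v_pv_{n-2-p}].$$ **Theorem.** Let $f$ be as above with $M(f)=0$ and condition (III). Let $\chi>0$ and $\mathcal Q$ be such that the Fourier coefficients $Q_m$ of $q=\sum_mQ_me^{im\omega t}$ and $Q^{(2)}_m$ of $\mathcal Q_0=\sum_mQ^{(2)}_me^{im\omega t}$ satisfy $$|Q_m|\le\mathcal Q\,\frac{e^{-\chi|m|}}{\langle m\rangle^2},\qquad|Q^{(2)}_m|\le\mathcal Q\,\frac{e^{-\chi|m|}}{\langle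 m\rangle^2}\qquad\text{for all }m\in\mathbb Z.$$ Then constants $\kappa_n$ as above exist, and for every such choice all $v_n$, $n\ge1$, are periodic with period $2\pi/\omega$ and are the sums of their Fourier series $v_n(t)=\sum_{m\in\mathbb Z}V^{(n)}_me^{im\omega t}$, and there are constants $M_0,M_1>0$ such that $$\big|V^{(n)}_m\big|\le M_0M_1^n\,\frac{e^{-\chi|m|}}{\langle m\rangle^2}\qquad\text{for all }m\in\mathbb Z,\ n\ge1.$$ Consequently, for every real $\epsilon$ with $|\epsilon|<1/M_1$ the series $g(t)=q(t)\sum_{n=1}^\infty v_n(t)\epsilon^n$ converges uniformly in $t\in\mathbb R$, and its sum is a solution of the generalised Riccati equation $\dot g-ig^2-2ifg+i\epsilon^2=0$ on $\mathbb R$. -/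

import Mathlib

open Filter Topology

noncomputable section

namespace Secular

/-- The mean value `M(h) = lim_{T → ∞} (1 / 2T) ∫_{-T}^{T} h(t) dt`. -/
def mean (h : ℝ → ℂ) : ℂ :=
  limUnder atTop (fun T : ℝ => (1 / (2 * (T : ℂ))) * ∫ t in (-T)..T, h t)

/-- The renormalisation operator acting on `(a₁ | a₂ | ⋯ | aₙ)`:
`ren [a] = a` and
`ren [a₁, …, aₙ] t = a₁ t * ∫₀ᵗ (ren [a₂, …, aₙ] τ - M (ren [a₂, …, aₙ])) dτ`. -/
def ren : List (ℝ → ℂ) → ℝ → ℂ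
  | [] => fun _ => 0
  | [a] => a
  | a :: b :: l => fun t => a t * ∫ τ in (0 : ℝ)..t, (ren (b :: l) τ - mean (ren (b :: l)))

/-- `q(t) = exp (i ∫₀ᵗ f)`. -/
def q (f : ℝ → ℝ) (t : ℝ) : ℂ :=
  Complex.exp (Complex.I * ((∫ τ in (0 : ℝ)..t, f τ : ℝ) : ℂ))

def Q0 (f : ℝ → ℝ) (t : ℝ) : ℂ := q f t ^ 2

def Q1 (f : ℝ → ℝ) (t : ℝ) : ℂ :=
  Q0 f t * ∫ τ in (0 : ℝ)..t, ((Q0 f τ)⁻¹ - mean (fun s => (Q0 f s)⁻¹))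

def Q2 (f : ℝ → ℝ) (t : ℝ) : ℂ :=
  Q0 f t * ∫ τ in (0 : ℝ)..t, (Q0 f τ - mean (Q0 f))

def Q3 (f : ℝ → ℝ) (t : ℝ) : ℂ :=
  Q0 f t * ∫ τ in (0 : ℝ)..t, (Q1 f τ - mean (Q1 f))

/-- Condition (III): `M(Q₀) = M(Q₁) = 0` but `M(Q₃) ≠ 0`. -/
def ConditionIII (f : ℝ → ℝ) : Prop :=
  mean (Q0 f) = 0 ∧ mean (Q1 f) = 0 ∧ mean (Q3 f) ≠ 0

/-- The functions `vₙ`, `n ≥ 1`, for given integration constants `κₙ`, `n ≥ 1`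
(the values `κ 0` and `v f κ 0` play no role). -/
def v (f : ℝ → ℝ) (κ : ℕ → ℂ) : ℕ → ℝ → ℂ
  | 0 => fun _ => 0
  | 1 => fun t => κ 1 * q f t
  | 2 => fun t => q f t *
      (Complex.I * (∫ τ in (0 : ℝ)..t, (κ 1 ^ 2 * Q0 f τ - (Q0 f τ)⁻¹)) + κ 2)
  | n + 3 => fun t => q f t *
      (Complex.I * (∫ τ in (0 : ℝ)..t,
        ∑ j : Fin (n + 2), v f κ (j + 1) τ * v f κ (n + 2 - j) τ) + κ (n + 3))
termination_by n => n
decreasing_by all_goals omega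

/-- The recursion for `vₙ`, `n ≥ 3`, with the sum indexed by `p = 1, …, n - 1`. -/
theorem v_eq (f : ℝ → ℝ) (κ : ℕ → ℂ) (n : ℕ) (hn : 3 ≤ n) (t : ℝ) :
    v f κ n t = q f t * (Complex.I * (∫ τ in (0 : ℝ)..t,
      ∑ p ∈ Finset.Icc 1 (n - 1), v f κ p τ * v f κ (n - p) τ) + κ n) := by
  obtain ⟨k, rfl⟩ : ∃ k, n = k + 3 := ⟨n - 3, by omega⟩
  have key : ∀ τ : ℝ,
      ∑ j : Fin (k + 2), v f κ (j + 1) τ * v f κ (k + 2 - j) τ =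
        ∑ p ∈ Finset.Icc 1 (k + 3 - 1), v f κ p τ * v f κ (k + 3 - p) τ := by
    intro τ
    rw [Fin.sum_univ_eq_sum_range (fun j => v f κ (j + 1) τ * v f κ (k + 2 - j) τ) (k + 2)]
    rw [Finset.range_eq_Ico, show Finset.Icc 1 (k + 3 - 1) = Finset.Ico (0 + 1) (k + 2 + 1) from by
      ext; simp, ← Finset.sum_Ico_add']
    refine Finset.sum_congr rfl fun j _ => ?_
    rw [show k + 3 - (j + 1) = k + 2 - j by omega]
  rw [v]
  simp only [key]

section Constants

variable (f : ℝ → ℝ) (κ : ℕ → ℂ)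

/-- The product `v_p v_r`. -/
def vv (p r : ℕ) (t : ℝ) : ℂ := v f κ p t * v f κ r t

/-- `l_m = i q² ∫₀ᵗ ∑_{p=1}^{m-1} v_p v_{m-p}`. -/
def l (m : ℕ) (t : ℝ) : ℂ :=
  Complex.I * q f t ^ 2 *
    ∫ τ in (0 : ℝ)..t, ∑ p ∈ Finset.Icc 1 (m - 1), v f κ p τ * v f κ (m - p) τ

/-- The part `-Q₀⁻¹ (κ₁² Q₂ - Q₁)²` of `v₂²` which contains `κ₁` only. -/
def s (t : ℝ) : ℂ := -(Q0 f t)⁻¹ * (κ 1 ^ 2 * Q2 f t - Q1 f t) ^ 2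

def A1 (t : ℝ) : ℂ :=
  -4 * κ 1 ^ 4 * ren [Q0 f, Q0 f, Q2 f] t
    + 4 * κ 1 ^ 2 * ren [Q0 f, Q0 f, Q1 f] t
    + ren [Q0 f, s f κ] t

def A2 (t : ℝ) : ℂ :=
  8 * κ 1 ^ 6 * ren [Q0 f, Q2 f, Q2 f] t
    - 8 * κ 1 ^ 4 * ren [Q0 f, Q2 f, Q1 f] t
    - 8 * Complex.I * κ 1 ^ 4 * κ 2 * ren [Q0 f, Q2 f, Q0 f] t
    - 8 * κ 1 ^ 4 * ren [Q0 f, Q1 f, Q2 f] t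
    + 8 * κ 1 ^ 2 * ren [Q0 f, Q1 f, Q1 f] t
    + 8 * Complex.I * κ 1 ^ 2 * κ 2 * ren [Q0 f, Q1 f, Q0 f] t
    + 16 * Complex.I * κ 1 ^ 2 * κ 2 * ren [Q0 f, Q0 f, Q1 f] t
    - 32 * Complex.I * κ 1 ^ 4 * κ 2 * ren [Q0 f, Q0 f, Q2 f] t
    - 12 * κ 1 ^ 2 * κ 2 ^ 2 * ren [Q0 f, Q2 f] t
    - 4 * κ 1 ^ 2 * ren [Q0 f, A1 f κ] t

def A3 (t : ℝ) : ℂ :=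
  8 * κ 1 ^ 6 * ren [Q2 f, Q0 f, Q2 f] t
    - 8 * κ 1 ^ 4 * ren [Q2 f, Q0 f, Q1 f] t
    - 8 * Complex.I * κ 1 ^ 4 * κ 2 * ren [Q2 f, Q0 f, Q0 f] t
    - 8 * κ 1 ^ 4 * ren [Q1 f, Q0 f, Q2 f] t
    + 8 * κ 1 ^ 2 * ren [Q1 f, Q0 f, Q1 f] t
    + 8 * Complex.I * κ 1 ^ 2 * κ 2 * ren [Q1 f, Q0 f, Q0 f] t
    - 8 * Complex.I * κ 1 ^ 4 * κ 2 * ren [Q0 f, Q0 f, Q2 f] t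
    + 8 * Complex.I * κ 1 ^ 2 * κ 2 * ren [Q0 f, Q0 f, Q1 f] t
    - 8 * κ 1 ^ 2 * κ 2 ^ 2 * ren [Q0 f, Q0 f, Q0 f] t
    - 2 * κ 1 ^ 2 * ren [Q2 f, vv f κ 2 2] t
    + 2 * ren [Q1 f, vv f κ 2 2] t
    + 2 * Complex.I * κ 2 * ren [Q0 f, vv f κ 2 2] t

def A4 (t : ℝ) : ℂ :=
  (Q0 f t)⁻¹ *
    (Complex.I * κ 1 ^ 3 * ren [Q0 f, Q2 f] t
      - Complex.I * κ 1 * ren [Q0 f, Q1 f] t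
      + κ 1 * κ 2 * Q2 f t) ^ 2

/-- The term `R⁽¹⁾ₙ`, `n ≥ 7`. -/
def R1 (n : ℕ) : ℂ :=
  2 * Complex.I * κ 1 * ∑ p ∈ Finset.Icc 1 (n - 4),
      (-2 * κ 1 ^ 2 * mean (ren [Q0 f, Q0 f, Q0 f, vv f κ p (n - 3 - p)])
        + mean (ren [Q0 f, Q1 f, vv f κ p (n - 3 - p)])
        - κ 1 ^ 2 * mean (ren [Q0 f, Q2 f, vv f κ p (n - 3 - p)])
        + Complex.I * κ 2 * mean (ren [Q0 f, Q0 f, vv f κ p (n - 3 - p)]))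
    - 2 * κ 1 ^ 2 * ∑ p ∈ Finset.Icc 2 (n - 4),
        mean (ren [Q0 f, Q0 f, vv f κ p (n - 2 - p)])
    + Complex.I * κ 1 * ∑ p ∈ Finset.Icc 3 (n - 4),
        mean (ren [Q0 f, vv f κ p (n - 1 - p)])

/-- The term `R⁽²⁾ₙ`, `n ≥ 7`. -/
def R2 (n : ℕ) : ℂ :=
  -2 * κ 1 * ∑ p ∈ Finset.Icc 1 (n - 4),
      mean (ren [fun t => q f t * v f κ 2 t, Q0 f, vv f κ p (n - 3 - p)])
    + Complex.I * ∑ p ∈ Finset.Icc 2 (n - 4),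
      mean (ren [fun t => q f t * v f κ 2 t, vv f κ p (n - 2 - p)])

/-- The explicit recursive choice of the constants `κₙ`, `n ≥ 1`, which eliminates the secular
terms under condition (III). Here `κ₁` may be either square root; the right-hand sides for
`κ₂`, `κ₃` and `κ_{n-3}` depend only on constants with smaller index, so `κₙ`, `n ≥ 1`, is
determined by the choice of `κ₁`. -/
structure IsSecularChoice : Prop where
  kappa_one : κ 1 ^ 2 = (starRingEnd ℂ) (mean (Q3 f)) / mean (Q3 f)
  kappa_two : κ 2 = -(Complex.I * mean (A1 f κ)) / (2 * mean (Q3 f))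
  kappa_three : κ 3 =
    (4 * mean (A4 f κ) - mean (A3 f κ) - mean (A2 f κ)) / (4 * κ 1 * mean (Q3 f))
  kappa_rec : ∀ n : ℕ, 7 ≤ n → κ (n - 3) =
    -1 / (4 * κ 1 * mean (Q3 f)) *
      (∑ p ∈ Finset.Icc 4 (n - 4), mean (vv f κ p (n - p))
        + 2 * R1 f κ n + 2 * R2 f κ n
        + 2 * mean (fun t => (q f t)⁻¹ * v f κ 3 t * l f κ (n - 3) t))

end Constants

/-- The Fourier coefficient `(ω / 2π) ∫₀^{2π/ω} h(t) e^{-imωt} dt` of a function of period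
`2π/ω`. -/
def coef {ω : ℝ} (hω : 0 < ω) (h : ℝ → ℂ) (m : ℤ) : ℂ :=
  fourierCoeffOn (show (0 : ℝ) < 2 * Real.pi / ω by positivity) h m

/-- `⟨m⟩ = |m|` for `m ≠ 0`, and `⟨0⟩ = 1`. -/
def bra (m : ℤ) : ℝ := if m = 0 then 1 else |(m : ℝ)|

/-- The partial sum `q(t) ∑_{n=1}^{N} vₙ(t) εⁿ` of the expansion of `g`. -/
def gPartial (f : ℝ → ℝ) (κ : ℕ → ℂ) (ε : ℝ) (N : ℕ) (t : ℝ) : ℂ :=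
  q f t * ∑ n ∈ Finset.Icc 1 N, v f κ n t * (ε : ℂ) ^ n

end Secular

end

/-! A secular term can enter `v n` only if its integrand, for `n ≥ 3` the convolution `conv v n`,
has non-zero mean. The functions `pv` subtract the mean before each integration and are therefore
periodic for arbitrary constants. It then suffices to show that the prescribed constants make every
subtracted mean vanish, so that `v n = pv n`, and to bound the Fourier coefficients of `pv n`.

Vanishing of the means. Let `M` be the mean, `J` the periodic primitive vanishing at `0`, `x = q²`,
`y = q⁻²`. Only integration by parts and the product rule for `J` are needed, which `Expansion`
isolates. Condition (III) gives `M x = M y = M (x J y) = 0`, and the iterated integrals of `x` alone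
that occur also have mean zero. Hence unrolling the recursion inside `M (conv v n)` removes `κ
(n-1)` and `κ (n-2)` and leaves `κ (n-3)` with coefficient `4 κ₁ μ`, plus terms in earlier constants
(`mean_conv`). As `κ₁ μ ≠ 0`, the formula for `κ (n-3)` is the equation `M (conv v n) = 0` solved.
Orders 4, 5, 6 yield `κ₁²`, `κ₂`, `κ₃` in the same way, and order 3 is automatic. The induction is
`IsSecularChoice.v_eq_pv`.

Estimates. The weight `e^{-χ|m|}/⟨m⟩²` is stable under convolution, and `J` divides the `m`-th
coefficient by `imω`, so products and primitives are bounded operations. Because `κ n` comes from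
the condition at order `n + 3`, `v n` is controlled by sums of `v p * v r` with `p + r = n + j`, `0
≤ j ≤ 3` and `p, r < n` (`exists_fBound_pv`). A majorant `δ Mⁿ⁻³/n²` closes this recursion
(`exists_majorant`): `1/n²` makes the sums over `p` uniformly bounded, small `δ` handles products of
two high-index factors, and large `M` those with a low-index factor.

Finally, `q⁻¹ v n` has derivative `i (conv v n)`, with the extra term `-i q⁻²` at `n = 2`. Termwise
differentiation and the Cauchy product turn this into the Riccati equation. -/

noncomputable section

namespace Secular

/-! ### Periodic functions, their mean and their periodic primitive. -/

/-- The algebra of continuous functions with period `2π/ω`. -/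
def PerAlg (ω : ℝ) : Subalgebra ℂ (ℝ → ℂ) where
  carrier := {h | Continuous h ∧ Function.Periodic h (2 * Real.pi / ω)}
  mul_mem' ha hb := ⟨ha.1.mul hb.1, ha.2.mul hb.2⟩
  add_mem' ha hb := ⟨ha.1.add hb.1, ha.2.add hb.2⟩
  algebraMap_mem' _ := ⟨continuous_const, fun _ => rfl⟩

section PerAlg

variable {ω : ℝ}

theorem PerAlg.continuous (h : PerAlg ω) : Continuous (h : ℝ → ℂ) := h.2.1

theorem PerAlg.periodic (h : PerAlg ω) : Function.Periodic (h : ℝ → ℂ) (2 * Real.pi / ω) := h.2.2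

theorem PerAlg.intervalIntegrable (h : PerAlg ω) (a b : ℝ) :
    IntervalIntegrable (h : ℝ → ℂ) MeasureTheory.volume a b :=
  (PerAlg.continuous h).intervalIntegrable a b

@[simp] theorem PerAlg.add_apply (h k : PerAlg ω) (t : ℝ) :
    ((h + k : PerAlg ω) : ℝ → ℂ) t = (h : ℝ → ℂ) t + (k : ℝ → ℂ) t := rfl

@[simp] theorem PerAlg.sub_apply (h k : PerAlg ω) (t : ℝ) :
    ((h - k : PerAlg ω) : ℝ → ℂ) t = (h : ℝ → ℂ) t - (k : ℝ → ℂ) t := rfl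

@[simp] theorem PerAlg.neg_apply (h : PerAlg ω) (t : ℝ) :
    ((-h : PerAlg ω) : ℝ → ℂ) t = -(h : ℝ → ℂ) t := rfl

@[simp] theorem PerAlg.mul_apply (h k : PerAlg ω) (t : ℝ) :
    ((h * k : PerAlg ω) : ℝ → ℂ) t = (h : ℝ → ℂ) t * (k : ℝ → ℂ) t := rfl

@[simp] theorem PerAlg.pow_apply (h : PerAlg ω) (n : ℕ) (t : ℝ) :
    ((h ^ n : PerAlg ω) : ℝ → ℂ) t = (h : ℝ → ℂ) t ^ n := rfl

@[simp] theorem PerAlg.smul_apply (c : ℂ) (h : PerAlg ω) (t : ℝ) :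
    ((c • h : PerAlg ω) : ℝ → ℂ) t = c * (h : ℝ → ℂ) t := rfl

@[simp] theorem PerAlg.one_apply (t : ℝ) : ((1 : PerAlg ω) : ℝ → ℂ) t = 1 := rfl

@[simp] theorem PerAlg.zero_apply (t : ℝ) : ((0 : PerAlg ω) : ℝ → ℂ) t = 0 := rfl

@[simp] theorem PerAlg.sum_apply {ι : Type*} (s : Finset ι) (h : ι → PerAlg ω) (t : ℝ) :
    ((∑ i ∈ s, h i : PerAlg ω) : ℝ → ℂ) t = ∑ i ∈ s, (h i : ℝ → ℂ) t := by
  induction s using Finset.cons_induction with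
  | empty => simp
  | cons a s ha ih => rw [Finset.sum_cons, Finset.sum_cons, PerAlg.add_apply, ih]

@[ext] theorem PerAlg.ext {h k : PerAlg ω} (H : ∀ t, (h : ℝ → ℂ) t = (k : ℝ → ℂ) t) : h = k :=
  Subtype.ext (funext H)

/-- The average over one period. -/
def avg (ω : ℝ) : PerAlg ω →ₗ[ℂ] ℂ where
  toFun h := (ω / (2 * Real.pi) : ℝ) * ∫ t in (0 : ℝ)..(2 * Real.pi / ω), (h : ℝ → ℂ) t
  map_add' h k := by
    simp only [PerAlg.add_apply]
    rw [intervalIntegral.integral_add ((PerAlg.intervalIntegrable h) _ _) ((PerAlg.intervalIntegrable k) _ _)]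
    ring
  map_smul' c h := by
    simp only [PerAlg.smul_apply, intervalIntegral.integral_const_mul, RingHom.id_apply,
      smul_eq_mul]
    ring

theorem avg_apply (h : PerAlg ω) :
    avg ω h = (ω / (2 * Real.pi) : ℝ) * ∫ t in (0 : ℝ)..(2 * Real.pi / ω), (h : ℝ → ℂ) t := rfl

/-- Complex conjugation on periodic functions. -/
def cconj (h : PerAlg ω) : PerAlg ω :=
  ⟨fun t => (starRingEnd ℂ) ((h : ℝ → ℂ) t), Complex.continuous_conj.comp (PerAlg.continuous h),
    fun t => by simp only [(PerAlg.periodic h) t]⟩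

@[simp] theorem cconj_apply (h : PerAlg ω) (t : ℝ) :
    (cconj h : ℝ → ℂ) t = (starRingEnd ℂ) ((h : ℝ → ℂ) t) := rfl

theorem cconj_mul (h k : PerAlg ω) : cconj (h * k) = cconj h * cconj k := by ext t; simp

theorem intervalIntegral_conj (h : ℝ → ℂ) (a b : ℝ) :
    ∫ t in a..b, (starRingEnd ℂ) (h t) = (starRingEnd ℂ) (∫ t in a..b, h t) := by
  simp only [intervalIntegral, integral_conj, map_sub]

theorem avg_cconj (h : PerAlg ω) : avg ω (cconj h) = (starRingEnd ℂ) (avg ω h) := by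
  simp only [avg_apply, cconj_apply, intervalIntegral_conj, map_mul, Complex.conj_ofReal]

theorem hasDerivAt_primitive (h : PerAlg ω) (t : ℝ) :
    HasDerivAt (fun t => ∫ τ in (0 : ℝ)..t, ((h : ℝ → ℂ) τ - avg ω h))
      ((h : ℝ → ℂ) t - avg ω h) t :=
  have hc : Continuous fun τ => (h : ℝ → ℂ) τ - avg ω h :=
    (PerAlg.continuous h).sub continuous_const
  intervalIntegral.integral_hasDerivAt_right (hc.intervalIntegrable _ _)
    (hc.stronglyMeasurableAtFilter _ _) hc.continuousAt

theorem integral_sub_avg (h : PerAlg ω) (a b : ℝ) :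
    ∫ τ in a..b, ((h : ℝ → ℂ) τ - avg ω h) =
      (∫ τ in a..b, (h : ℝ → ℂ) τ) - ((b - a : ℝ) : ℂ) * avg ω h := by
  rw [intervalIntegral.integral_sub ((PerAlg.intervalIntegrable h) _ _) (by simp),
    intervalIntegral.integral_const, Complex.real_smul]

variable [hω : Fact (0 < ω)]

theorem integral_period (h : PerAlg ω) :
    ∫ t in (0 : ℝ)..(2 * Real.pi / ω), (h : ℝ → ℂ) t = (2 * Real.pi / ω : ℝ) * avg ω h := by
  have h1 := hω.out
  have h2 := Real.pi_pos
  rw [avg_apply, ← mul_assoc, ← Complex.ofReal_mul]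
  rw [show 2 * Real.pi / ω * (ω / (2 * Real.pi)) = 1 by field_simp]
  simp

theorem avg_one : avg ω 1 = 1 := by
  have h1 := hω.out
  have h2 := Real.pi_pos
  rw [avg_apply]
  simp only [PerAlg.one_apply, intervalIntegral.integral_const, sub_zero]
  rw [Complex.real_smul, mul_one, ← Complex.ofReal_mul]
  rw [show ω / (2 * Real.pi) * (2 * Real.pi / ω) = 1 by field_simp]
  simp

/-- The periodic primitive `t ↦ ∫₀ᵗ (h - M h)`. -/
def prim (ω : ℝ) [Fact (0 < ω)] : PerAlg ω →ₗ[ℂ] PerAlg ω where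
  toFun h := ⟨fun t => ∫ τ in (0 : ℝ)..t, ((h : ℝ → ℂ) τ - avg ω h),
    continuous_iff_continuousAt.2 fun t => (hasDerivAt_primitive h t).continuousAt, fun t => by
      have hint : ∀ a b, IntervalIntegrable (fun τ => (h : ℝ → ℂ) τ - avg ω h)
          MeasureTheory.volume a b :=
        ((PerAlg.continuous h).sub continuous_const).intervalIntegrable
      have hp : Function.Periodic (fun τ => (h : ℝ → ℂ) τ - avg ω h) (2 * Real.pi / ω) :=
        fun τ => by simp only [(PerAlg.periodic h) τ]
      simp only
      rw [← intervalIntegral.integral_add_adjacent_intervals (hint 0 t) (hint t _),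
        hp.intervalIntegral_add_eq t 0, zero_add, integral_sub_avg h 0 (2 * Real.pi / ω),
        integral_period]
      simp⟩
  map_add' h k := by
    ext t
    simp only [PerAlg.add_apply, map_add]
    rw [← intervalIntegral.integral_add]
    · congr 1; ext τ; ring
    · exact ((PerAlg.continuous h).sub continuous_const).intervalIntegrable _ _
    · exact ((PerAlg.continuous k).sub continuous_const).intervalIntegrable _ _
  map_smul' c h := by
    ext t
    simp only [PerAlg.smul_apply, map_smul, smul_eq_mul, RingHom.id_apply]
    rw [← intervalIntegral.integral_const_mul]
    congr 1; ext τ; ring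

theorem prim_apply (h : PerAlg ω) (t : ℝ) :
    (prim ω h : ℝ → ℂ) t = ∫ τ in (0 : ℝ)..t, ((h : ℝ → ℂ) τ - avg ω h) := rfl

@[simp] theorem prim_zero_apply (h : PerAlg ω) : (prim ω h : ℝ → ℂ) 0 = 0 := by
  simp [prim_apply]

theorem hasDerivAt_prim (h : PerAlg ω) (t : ℝ) :
    HasDerivAt (prim ω h : ℝ → ℂ) ((h : ℝ → ℂ) t - avg ω h) t :=
  hasDerivAt_primitive h t

/-- A periodic function which vanishes at `0` is the periodic primitive of its derivative, and the
derivative has mean zero. -/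
theorem eq_prim_of_hasDerivAt {h k : PerAlg ω} (h0 : (h : ℝ → ℂ) 0 = 0)
    (hk : ∀ t, HasDerivAt (h : ℝ → ℂ) ((k : ℝ → ℂ) t) t) : avg ω k = 0 ∧ h = prim ω k := by
  have key : ∀ t : ℝ, ∫ τ in (0 : ℝ)..t, (k : ℝ → ℂ) τ = (h : ℝ → ℂ) t := fun t => by
    rw [intervalIntegral.integral_eq_sub_of_hasDerivAt (fun τ _ => hk τ) ((PerAlg.intervalIntegrable k) _ _),
      h0, sub_zero]
  have hM : avg ω k = 0 := by
    rw [avg_apply, key, ← zero_add (2 * Real.pi / ω), (PerAlg.periodic h), h0, mul_zero]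
  refine ⟨hM, ?_⟩
  ext t
  rw [prim_apply, hM, ← key t]
  simp

/-- The product of two periodic primitives is periodic and vanishes at `0`, so it is the primitive
of its own derivative. This one observation gives both integration by parts and the product rule for
`prim`. -/
theorem prim_mul_prim_aux (h k : PerAlg ω) :
    avg ω ((h - avg ω h • 1) * prim ω k + prim ω h * (k - avg ω k • 1)) = 0 ∧
      prim ω h * prim ω k =
        prim ω ((h - avg ω h • 1) * prim ω k + prim ω h * (k - avg ω k • 1)) := by
  refine eq_prim_of_hasDerivAt (by simp) fun t => ?_
  have := (hasDerivAt_prim h t).mul (hasDerivAt_prim k t)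
  simpa using this

theorem prim_mul_prim {h k : PerAlg ω} (hh : avg ω h = 0) (hk : avg ω k = 0) :
    prim ω h * prim ω k = prim ω (h * prim ω k + prim ω h * k) := by
  simpa [hh, hk] using (prim_mul_prim_aux h k).2

theorem avg_mul_prim (h k : PerAlg ω) :
    avg ω (h * prim ω k) + avg ω (prim ω h * k) =
      avg ω h * avg ω (prim ω k) + avg ω k * avg ω (prim ω h) := by
  have := (prim_mul_prim_aux h k).1
  simp only [sub_mul, mul_sub, smul_mul_assoc, mul_smul_comm, one_mul, mul_one, map_add, map_sub,
    map_smul, smul_eq_mul] at this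
  linear_combination this

/-- The symmetric average over `[-T, T]` differs from the period average by `(P T - P (-T)) / 2T`,
where `P = prim ω h` is continuous and periodic, hence bounded. -/
theorem mean_eq_avg (h : PerAlg ω) : mean (h : ℝ → ℂ) = avg ω h := by
  apply Tendsto.limUnder_eq
  obtain ⟨B, hB⟩ : ∃ B, ∀ t, ‖(prim ω h : ℝ → ℂ) t‖ ≤ B := by
    have hT : 0 < 2 * Real.pi / ω := by have := hω.out; positivity
    obtain ⟨B, hB⟩ := ((PerAlg.periodic (prim ω h)).compact_of_continuous hT.ne'
      (PerAlg.continuous (prim ω h))).isBounded.exists_norm_le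
    exact ⟨B, fun t => hB _ ⟨t, rfl⟩⟩
  have hlim : Tendsto (fun T : ℝ => (1 / (2 * (T : ℂ))) *
      ((prim ω h : ℝ → ℂ) T - (prim ω h : ℝ → ℂ) (-T))) atTop (𝓝 0) := by
    refine squeeze_zero_norm' (a := fun T : ℝ => B * T⁻¹) ?_ ?_
    · filter_upwards [eventually_gt_atTop 0] with T hT
      rw [norm_mul, norm_div, norm_mul, Complex.norm_real, Real.norm_of_nonneg hT.le]
      simp only [norm_one, Complex.norm_ofNat]
      have h1 := (norm_sub_le ((prim ω h : ℝ → ℂ) T) ((prim ω h : ℝ → ℂ) (-T))).trans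
        (add_le_add (hB _) (hB _))
      calc 1 / (2 * T) * ‖(prim ω h : ℝ → ℂ) T - (prim ω h : ℝ → ℂ) (-T)‖
          ≤ 1 / (2 * T) * (B + B) := by gcongr
        _ = B * T⁻¹ := by field_simp; ring
    · simpa using tendsto_inv_atTop_zero.const_mul B
  have h2 := hlim.add_const (avg ω h)
  rw [zero_add] at h2
  refine h2.congr' ?_
  filter_upwards [eventually_gt_atTop 0] with T hT
  have hT' : (T : ℂ) ≠ 0 := by exact_mod_cast hT.ne'
  have hint : ∀ a b, IntervalIntegrable (fun τ => (h : ℝ → ℂ) τ - avg ω h)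
      MeasureTheory.volume a b := ((PerAlg.continuous h).sub continuous_const).intervalIntegrable
  rw [prim_apply, prim_apply, intervalIntegral.integral_interval_sub_left (hint _ _) (hint _ _),
    integral_sub_avg]
  push_cast
  field_simp
  ring

theorem prim_cconj (h : PerAlg ω) : prim ω (cconj h) = cconj (prim ω h) := by
  ext t
  simp only [prim_apply, cconj_apply, avg_cconj, ← map_sub, intervalIntegral_conj]

end PerAlg

/-! ### Mean identities in the abstract expansion, orders 3 and 4. -/

section Algebra

variable {A : Type*} [CommRing A] [Algebra ℂ A]

/-- The Cauchy convolution `∑_{p=1}^{n-1} v_p v_{n-p}`. -/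
def conv (v : ℕ → A) (n : ℕ) : A := ∑ p ∈ Finset.Icc 1 (n - 1), v p * v (n - p)

/-- An abstract version of the renormalised expansion: `M` is a mean value, `J` a primitive operator
on functions modulo their mean, `x = q²` and `y = q⁻²`. -/
structure Expansion (M : A →ₗ[ℂ] ℂ) (J : A →ₗ[ℂ] A) (q qi x y : A) (κ : ℕ → ℂ) (v : ℕ → A) :
    Prop where
  parts : ∀ h k, M (h * J k) + M (J h * k) = M h * M (J k) + M k * M (J h)
  prim_mul : ∀ h k, M h = 0 → M k = 0 → J h * J k = J (h * J k + J h * k)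
  mul_inv : q * qi = 1
  sq : q * q = x
  inv_sq : qi * qi = y
  mean_x : M x = 0
  mean_y : M y = 0
  mean_xy : M (x * J y) = 0
  one : v 1 = κ 1 • q
  two : v 2 = q * (Complex.I • J (κ 1 ^ 2 • x - y) + κ 2 • 1)
  step : ∀ n, 3 ≤ n → v n = q * (Complex.I • J (conv v n) + κ n • 1)

namespace Expansion

variable {M : A →ₗ[ℂ] ℂ} {J : A →ₗ[ℂ] A} {q qi x y : A} {κ : ℕ → ℂ} {v : ℕ → A}

theorem parts_zero (H : Expansion M J q qi x y κ v) {h k : A} (hh : M h = 0) (hk : M k = 0) :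
    M (J h * k) = -M (h * J k) := by
  linear_combination H.parts h k + M (J k) * hh + M (J h) * hk

theorem mean_mul_prim_self (H : Expansion M J q qi x y κ v) {h : A} (hh : M h = 0) :
    M (h * J h) = 0 := by
  have h1 := H.parts_zero hh hh
  rw [mul_comm] at h1
  linear_combination h1 / 2

theorem prim_mul_self (H : Expansion M J q qi x y κ v) {h : A} (hh : M h = 0) :
    J h * J h = (2 : ℂ) • J (h * J h) := by
  rw [H.prim_mul h h hh hh, mul_comm (J h) h, ← two_smul ℂ, map_smul]

theorem mean_xx (H : Expansion M J q qi x y κ v) : M (x * J x) = 0 :=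
  H.mean_mul_prim_self H.mean_x

/-- Integrating by parts and using `J (x * J x) = (J x)² / 2` gives `m = -m/2` for this mean `m`. -/
theorem mean_prim_x_xx (H : Expansion M J q qi x y κ v) : M (J x * (x * J x)) = 0 := by
  have h1 := H.parts_zero H.mean_x H.mean_xx
  have h2 : x * J (x * J x) = (2⁻¹ : ℂ) • (J x * (x * J x)) := by
    rw [mul_left_comm, H.prim_mul_self H.mean_x, mul_smul_comm, smul_smul]
    norm_num
  rw [h2, map_smul, smul_eq_mul] at h1
  linear_combination (2 / 3) * h1

theorem mean_xxx (H : Expansion M J q qi x y κ v) : M (x * J (x * J x)) = 0 := by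
  have h1 := H.parts_zero H.mean_x H.mean_xx
  rw [H.mean_prim_x_xx] at h1
  linear_combination h1

/-- By parts, the outer integration moves onto the first factor and leaves `h * J h` with `h = x * J
x`, a function of mean zero times its own primitive. -/
theorem mean_xxxx (H : Expansion M J q qi x y κ v) : M (x * J (x * J (x * J x))) = 0 := by
  have h1 := H.parts_zero H.mean_x H.mean_xxx
  have h2 := H.mean_mul_prim_self H.mean_xx
  rw [← mul_assoc, mul_comm (J x) x, h2] at h1
  linear_combination h1

theorem mean_prim_x_xy (H : Expansion M J q qi x y κ v) :
    M (J x * (x * J y)) = -M (x * J (x * J y)) :=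
  H.parts_zero H.mean_x H.mean_xy

theorem q_mul_two (H : Expansion M J q qi x y κ v) :
    q * v 2 = (Complex.I * κ 1 ^ 2) • (x * J x) - Complex.I • (x * J y) + κ 2 • x := by
  rw [H.two, ← mul_assoc, H.sq]
  simp only [mul_add, map_sub, map_smul, mul_smul_comm, mul_sub, smul_sub, smul_smul, mul_one]

theorem mean_q_mul_two (H : Expansion M J q qi x y κ v) : M (q * v 2) = 0 := by
  rw [H.q_mul_two]
  simp [H.mean_xx, H.mean_xy, H.mean_x]

theorem mean_q_mul_two_prim_x (H : Expansion M J q qi x y κ v) :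
    M (q * v 2 * J x) = Complex.I * M (x * J (x * J y)) := by
  rw [H.q_mul_two]
  have h1 := H.mean_prim_x_xx
  have h2 := H.mean_prim_x_xy
  have h3 := H.mean_xx
  rw [mul_comm] at h1 h2
  simp only [add_mul, sub_mul, smul_mul_assoc, map_add, map_sub, map_smul, smul_eq_mul, h1, h2, h3]
  ring

/-- In `q * v 2` only the `x * J y` term survives, and it produces `μ = M (x * J (x * J y))`. This
and `mean_q_mul_two_prim_x` are the sources of the coefficient of `κ (n - 3)` in the contributions
of `v (n - 1)` and `v (n - 2)`. -/
theorem mean_x_prim_q_mul_two (H : Expansion M J q qi x y κ v) :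
    M (x * J (q * v 2)) = -(Complex.I * M (x * J (x * J y))) := by
  rw [← H.mean_q_mul_two_prim_x, mul_comm (q * v 2), H.parts_zero H.mean_x H.mean_q_mul_two,
    neg_neg]

theorem q_mul (H : Expansion M J q qi x y κ v) {n : ℕ} (hn : 3 ≤ n) :
    q * v n = Complex.I • (x * J (conv v n)) + κ n • x := by
  rw [H.step n hn, ← mul_assoc, H.sq]
  simp only [mul_add, mul_smul_comm, mul_one]

theorem two_mul_v (H : Expansion M J q qi x y κ v) {n : ℕ} (hn : 3 ≤ n) :
    v 2 * v n = Complex.I • (q * v 2 * J (conv v n)) + κ n • (q * v 2) := by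
  rw [H.step n hn]
  simp only [mul_add, mul_smul_comm, mul_one, mul_assoc, mul_left_comm (v 2) q, mul_comm (v 2) q]

theorem conv_three (H : Expansion M J q qi x y κ v) : conv v 3 = (2 * κ 1) • (q * v 2) := by
  rw [conv, show Finset.Icc 1 (3 - 1) = {1, 2} by decide, Finset.sum_pair (by decide), H.one,
    mul_comm (v 2), mul_smul, two_smul, smul_mul_assoc]

theorem conv_four (H : Expansion M J q qi x y κ v) :
    conv v 4 = (2 * κ 1) • (q * v 3) + v 2 * v 2 := by
  rw [conv, show Finset.Icc 1 (4 - 1) = {1, 2, 3} by decide, Finset.sum_insert (by decide),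
    Finset.sum_pair (by decide)]
  norm_num
  rw [H.one, mul_smul, two_smul, smul_mul_assoc, mul_comm (v 3), smul_mul_assoc]
  abel

theorem conv_five (H : Expansion M J q qi x y κ v) :
    conv v 5 = (2 * κ 1) • (q * v 4) + (2 : ℂ) • (v 2 * v 3) := by
  rw [conv, show Finset.Icc 1 (5 - 1) = {1, 2, 3, 4} by decide, Finset.sum_insert (by decide),
    Finset.sum_insert (by decide), Finset.sum_pair (by decide)]
  norm_num
  rw [H.one, mul_smul, two_smul, two_smul, smul_mul_assoc, mul_comm (v 4), smul_mul_assoc,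
    mul_comm (v 3)]
  abel

theorem conv_six (H : Expansion M J q qi x y κ v) :
    conv v 6 = (2 * κ 1) • (q * v 5) + (2 : ℂ) • (v 2 * v 4) + v 3 * v 3 := by
  rw [conv, show Finset.Icc 1 (6 - 1) = {1, 2, 3, 4, 5} by decide, Finset.sum_insert (by decide),
    Finset.sum_insert (by decide), Finset.sum_insert (by decide), Finset.sum_pair (by decide)]
  norm_num
  rw [H.one, mul_smul, two_smul, two_smul, smul_mul_assoc, mul_comm (v 5), smul_mul_assoc,
    mul_comm (v 4)]
  abel

theorem mean_conv_three (H : Expansion M J q qi x y κ v) : M (conv v 3) = 0 := by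
  rw [H.conv_three, map_smul, H.mean_q_mul_two, smul_zero]

theorem mean_q_mul_three (H : Expansion M J q qi x y κ v) :
    M (q * v 3) = 2 * κ 1 * M (x * J (x * J y)) := by
  rw [H.q_mul le_rfl, H.conv_three]
  simp only [map_add, map_smul, mul_smul_comm, smul_eq_mul, H.mean_x_prim_q_mul_two, H.mean_x]
  linear_combination (-2 * κ 1 * M (x * J (x * J y))) * Complex.I_mul_I

theorem two_mul_two (H : Expansion M J q qi x y κ v) :
    v 2 * v 2 = -(x * (κ 1 ^ 2 • J x - J y) ^ 2)
      + (2 * Complex.I * κ 2) • (κ 1 ^ 2 • (x * J x) - x * J y) + (κ 2 ^ 2) • x := by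
  have h : v 2 * v 2 = x * (Complex.I • (κ 1 ^ 2 • J x - J y) + κ 2 • 1) ^ 2 := by
    rw [H.two, ← H.sq, map_sub, map_smul]
    ring
  rw [h]
  generalize J x = X
  generalize J y = Y
  simp only [Algebra.smul_def, map_mul, map_pow, map_ofNat, mul_one]
  have hI : algebraMap ℂ A Complex.I * algebraMap ℂ A Complex.I = -1 := by
    rw [← map_mul, Complex.I_mul_I]; simp
  linear_combination (x * (algebraMap ℂ A (κ 1) ^ 2 * X - Y) ^ 2) * hI

/-- Write `(J y)² = 2 J (y * J y)` and integrate by parts twice. For `y` the conjugate of `x`, the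
right-hand side is twice the conjugate of `μ`. -/
theorem mean_y_prim (H : Expansion M J q qi x y κ v) :
    M (x * (J y * J y)) = 2 * M (y * J (y * J x)) := by
  have h1 : M (y * J x) = 0 := by
    rw [mul_comm, H.parts_zero H.mean_x H.mean_y, H.mean_xy, neg_zero]
  have h0 := H.mean_mul_prim_self H.mean_y
  have h2 := H.parts_zero H.mean_y h1
  have h3 := H.parts_zero H.mean_x h0
  rw [H.prim_mul_self H.mean_y, mul_smul_comm, map_smul, smul_eq_mul]
  rw [show J x * (y * J y) = J y * (y * J x) by ring] at h3
  linear_combination 2 * h3 - 2 * h2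

/-- In the application this is `2 κ₁² μ - 2 μ̄`, so its vanishing is the prescription for `κ₁²`. -/
theorem mean_conv_four (H : Expansion M J q qi x y κ v) :
    M (conv v 4) = 2 * κ 1 ^ 2 * M (x * J (x * J y)) - 2 * M (y * J (y * J x)) := by
  have h1 := H.mean_prim_x_xx
  have h2 := H.mean_prim_x_xy
  have h3 := H.mean_y_prim
  have h4 : x * (κ 1 ^ 2 • J x - J y) ^ 2 = (κ 1 ^ 4) • (J x * (x * J x))
      - (2 * κ 1 ^ 2) • (J x * (x * J y)) + x * (J y * J y) := by
    generalize J x = X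
    generalize J y = Y
    simp only [Algebra.smul_def, map_mul, map_pow, map_ofNat]
    ring
  rw [H.conv_four, H.two_mul_two, h4]
  simp only [map_add, map_sub, map_neg, map_smul, smul_eq_mul, H.mean_q_mul_three, H.mean_x,
    H.mean_xx, H.mean_xy, h1, h2, h3]
  ring

end Expansion

end Algebra

/-! ### Mean identities at order 5 and beyond. -/

section Algebra

variable {A : Type*} [CommRing A] [Algebra ℂ A]

section Coefficients

variable (J : A →ₗ[ℂ] A) (x y : A) (κ : ℕ → ℂ) (v : ℕ → A)

/-- The abstract counterpart of `A1`. -/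
def algA1 : A :=
  (-4 * κ 1 ^ 4) • (x * J (x * J (x * J x))) + (4 * κ 1 ^ 2) • (x * J (x * J (x * J y)))
    + x * J (-(x * (κ 1 ^ 2 • J x - J y) ^ 2))

/-- The abstract counterpart of `A2`. -/
def algA2 : A :=
  (8 * κ 1 ^ 6) • (x * J (x * J x * J (x * J x)))
    - (8 * κ 1 ^ 4) • (x * J (x * J x * J (x * J y)))
    - (8 * Complex.I * κ 1 ^ 4 * κ 2) • (x * J (x * J x * J x))
    - (8 * κ 1 ^ 4) • (x * J (x * J y * J (x * J x)))
    + (8 * κ 1 ^ 2) • (x * J (x * J y * J (x * J y)))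
    + (8 * Complex.I * κ 1 ^ 2 * κ 2) • (x * J (x * J y * J x))
    + (16 * Complex.I * κ 1 ^ 2 * κ 2) • (x * J (x * J (x * J y)))
    - (32 * Complex.I * κ 1 ^ 4 * κ 2) • (x * J (x * J (x * J x)))
    - (12 * κ 1 ^ 2 * κ 2 ^ 2) • (x * J (x * J x))
    - (4 * κ 1 ^ 2) • (x * J (algA1 J x y κ))

/-- The abstract counterpart of `A3`. -/
def algA3 : A :=
  (8 * κ 1 ^ 6) • (x * J x * J (x * J (x * J x)))
    - (8 * κ 1 ^ 4) • (x * J x * J (x * J (x * J y)))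
    - (8 * Complex.I * κ 1 ^ 4 * κ 2) • (x * J x * J (x * J x))
    - (8 * κ 1 ^ 4) • (x * J y * J (x * J (x * J x)))
    + (8 * κ 1 ^ 2) • (x * J y * J (x * J (x * J y)))
    + (8 * Complex.I * κ 1 ^ 2 * κ 2) • (x * J y * J (x * J x))
    - (8 * Complex.I * κ 1 ^ 4 * κ 2) • (x * J (x * J (x * J x)))
    + (8 * Complex.I * κ 1 ^ 2 * κ 2) • (x * J (x * J (x * J y)))
    - (8 * κ 1 ^ 2 * κ 2 ^ 2) • (x * J (x * J x))
    - (2 * κ 1 ^ 2) • (x * J x * J (v 2 * v 2))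
    + (2 : ℂ) • (x * J y * J (v 2 * v 2))
    + (2 * Complex.I * κ 2) • (x * J (v 2 * v 2))

/-- The abstract counterpart of `A4`. -/
def algA4 : A :=
  y * ((Complex.I * κ 1 ^ 3) • (x * J (x * J x)) - (Complex.I * κ 1) • (x * J (x * J y))
    + (κ 1 * κ 2) • (x * J x)) ^ 2

variable (M : A →ₗ[ℂ] ℂ) (q : A)

/-- The abstract counterpart of `R1`. -/
def algR1 (n : ℕ) : ℂ :=
  2 * Complex.I * κ 1 * ∑ p ∈ Finset.Icc 1 (n - 4),
      (-2 * κ 1 ^ 2 * M (x * J (x * J (x * J (v p * v (n - 3 - p)))))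
        + M (x * J (x * J y * J (v p * v (n - 3 - p))))
        - κ 1 ^ 2 * M (x * J (x * J x * J (v p * v (n - 3 - p))))
        + Complex.I * κ 2 * M (x * J (x * J (v p * v (n - 3 - p)))))
    - 2 * κ 1 ^ 2 * ∑ p ∈ Finset.Icc 2 (n - 4), M (x * J (x * J (v p * v (n - 2 - p))))
    + Complex.I * κ 1 * ∑ p ∈ Finset.Icc 3 (n - 4), M (x * J (v p * v (n - 1 - p)))

/-- The abstract counterpart of `R2`. -/
def algR2 (n : ℕ) : ℂ :=
  -2 * κ 1 * ∑ p ∈ Finset.Icc 1 (n - 4), M (q * v 2 * J (x * J (v p * v (n - 3 - p))))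
    + Complex.I * ∑ p ∈ Finset.Icc 2 (n - 4), M (q * v 2 * J (v p * v (n - 2 - p)))

end Coefficients

/-- The end terms `p = k` and `p = n - k` coincide by commutativity; `2 * k < n` keeps them
distinct. -/
theorem conv_succ_succ (v : ℕ → A) (n k : ℕ) (h1 : 1 ≤ k) (h2 : 2 * k < n) :
    ∑ p ∈ Finset.Icc k (n - k), v p * v (n - p) =
      (2 : ℂ) • (v k * v (n - k)) + ∑ p ∈ Finset.Icc (k + 1) (n - (k + 1)), v p * v (n - p) := by
  obtain ⟨m, rfl⟩ : ∃ m, n = m + 2 * k + 1 := ⟨n - 2 * k - 1, by omega⟩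
  rw [show m + 2 * k + 1 - k = m + k + 1 by omega, show m + 2 * k + 1 - (k + 1) = m + k by omega,
    Finset.sum_Icc_succ_top (by omega), ← Finset.add_sum_Ioc_eq_sum_Icc (by omega : k ≤ m + k),
    ← Finset.Icc_add_one_left_eq_Ioc, show m + 2 * k + 1 - (m + k + 1) = k by omega,
    show m + 2 * k + 1 - k = m + k + 1 by omega, mul_comm (v (m + k + 1)), two_smul]
  abel

namespace Expansion

variable {M : A →ₗ[ℂ] ℂ} {J : A →ₗ[ℂ] A} {q qi x y : A} {κ : ℕ → ℂ} {v : ℕ → A}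

theorem mean_x_prim_conv_four (H : Expansion M J q qi x y κ v) :
    M (x * J (conv v 4)) =
      M (algA1 J x y κ) - 2 * Complex.I * κ 2 * M (x * J (x * J y)) := by
  rw [H.conv_four, H.two_mul_two, H.q_mul le_rfl, H.conv_three, H.q_mul_two, algA1]
  simp only [map_add, map_sub, map_smul, mul_smul_comm, smul_eq_mul, mul_add, mul_sub, smul_add,
    smul_sub, H.mean_xx, H.mean_xxx]
  linear_combination (4 * κ 1 ^ 4 * M (x * J (x * J (x * J x)))
    - 4 * κ 1 ^ 2 * M (x * J (x * J (x * J y)))) * Complex.I_mul_I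

theorem mean_two_mul_three (H : Expansion M J q qi x y κ v) : M (v 2 * v 3) = 0 := by
  rw [H.two_mul_v le_rfl, H.conv_three]
  simp [H.mean_q_mul_two, H.mean_mul_prim_self H.mean_q_mul_two]

/-- Only the product of `v 1` and `v 4` contributes, since `M (v 2 * v 3) = 0`. The result is affine
in `κ₂` with slope `4 κ₁ μ`. -/
theorem mean_conv_five (H : Expansion M J q qi x y κ v) :
    M (conv v 5) = 2 * Complex.I * κ 1 *
      (M (algA1 J x y κ) - 2 * Complex.I * κ 2 * M (x * J (x * J y))) := by
  rw [H.conv_five, ← H.mean_x_prim_conv_four, H.q_mul (by norm_num : 3 ≤ 4)]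
  simp only [map_add, map_smul, smul_eq_mul, H.mean_two_mul_three, H.mean_x]
  ring

theorem mean_x_x_prim_conv_four (H : Expansion M J q qi x y κ v) :
    M (x * J (x * J (conv v 4))) = M (x * J (algA1 J x y κ))
      - 2 * Complex.I * κ 2 * M (x * J (x * J (x * J y))) := by
  rw [H.conv_four, H.two_mul_two, H.q_mul le_rfl, H.conv_three, H.q_mul_two, algA1]
  simp only [map_add, map_sub, map_smul, mul_smul_comm, smul_eq_mul, mul_add, mul_sub, smul_add,
    smul_sub, H.mean_xxx, H.mean_xxxx]
  linear_combination (4 * κ 1 ^ 4 * M (x * J (x * J (x * J (x * J x))))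
    - 4 * κ 1 ^ 2 * M (x * J (x * J (x * J (x * J y))))) * Complex.I_mul_I

theorem mean_one_mul_five (H : Expansion M J q qi x y κ v) :
    2 * κ 1 * M (q * v 5) = M (algA2 J x y κ) + 4 * κ 1 * κ 3 * M (x * J (x * J y)) := by
  have h1 := H.mean_x_x_prim_conv_four
  rw [H.q_mul (by norm_num : 3 ≤ 5), H.conv_five, H.q_mul (by norm_num : 3 ≤ 4),
    H.two_mul_v le_rfl, H.conv_three]
  have h2 := H.mean_x_prim_q_mul_two
  simp only [map_add, map_smul, mul_smul_comm, smul_eq_mul, mul_add, h1, h2, smul_add, H.mean_x,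
    H.mean_xx]
  rw [H.q_mul_two, algA2]
  simp only [map_add, map_sub, map_smul, mul_smul_comm, smul_mul_assoc, smul_eq_mul, mul_add,
    mul_sub, add_mul, sub_mul, smul_add, smul_sub, H.mean_xxx, H.mean_xxxx]
  ring_nf
  simp only [Complex.I_sq, show Complex.I ^ 3 = -Complex.I by rw [pow_succ, Complex.I_sq]; ring,
    show Complex.I ^ 4 = 1 by exact Complex.I_pow_four]
  ring

theorem mean_two_mul_four (H : Expansion M J q qi x y κ v) :
    2 * M (v 2 * v 4) = M (algA3 J x y κ v) - 4 * κ 1 * κ 3 * M (x * J (x * J y)) := by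
  have h2 := H.mean_q_mul_two_prim_x
  rw [H.two_mul_v (by norm_num : 3 ≤ 4), H.conv_four, H.q_mul le_rfl, H.conv_three]
  simp only [map_add, map_smul, mul_smul_comm, smul_eq_mul, mul_add, h2, smul_add,
    H.mean_q_mul_two]
  rw [H.q_mul_two, algA3]
  generalize v 2 * v 2 = V
  simp only [map_add, map_sub, map_smul, mul_smul_comm, smul_mul_assoc, smul_eq_mul, mul_add,
    mul_sub, add_mul, sub_mul, smul_add, smul_sub]
  ring_nf
  simp only [Complex.I_sq, show Complex.I ^ 3 = -Complex.I by rw [pow_succ, Complex.I_sq]; ring,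
    show Complex.I ^ 4 = 1 by exact Complex.I_pow_four]
  ring

theorem mean_three_mul_three (H : Expansion M J q qi x y κ v) :
    M (v 3 * v 3) = -4 * M (algA4 J x y κ) + 4 * κ 1 * κ 3 * M (x * J (x * J y)) := by
  have h1 : x * y = 1 := by
    rw [← H.sq, ← H.inv_sq]
    linear_combination (q * qi + 1) * H.mul_inv
  have h2 : v 3 * v 3 = (-4 : ℂ) • algA4 J x y κ
      + (2 * κ 3) • (q * v 3) - (κ 3 ^ 2) • x := by
    have h3 : x * J (conv v 3) = (2 : ℂ) • ((Complex.I * κ 1 ^ 3) • (x * J (x * J x))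
        - (Complex.I * κ 1) • (x * J (x * J y)) + (κ 1 * κ 2) • (x * J x)) := by
      rw [H.conv_three, H.q_mul_two]
      simp only [map_add, map_sub, map_smul, mul_smul_comm, mul_add, mul_sub]
      module
    have h4 : x * (J (conv v 3)) ^ 2 = (4 : ℂ) • algA4 J x y κ := by
      rw [show x * (J (conv v 3)) ^ 2 = y * (x * J (conv v 3)) ^ 2 by
        linear_combination (-x * (J (conv v 3)) ^ 2) * h1, h3, algA4, smul_pow, mul_smul_comm]
      norm_num
    have hI : algebraMap ℂ A Complex.I * algebraMap ℂ A Complex.I = -1 := by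
      rw [← map_mul, Complex.I_mul_I]; simp
    rw [neg_smul, ← h4, H.step 3 le_rfl, ← H.sq]
    generalize J (conv v 3) = X
    simp only [Algebra.smul_def, map_mul, map_pow, map_ofNat, mul_one]
    linear_combination (q ^ 2 * X ^ 2) * hI
  rw [h2]
  simp only [map_add, map_sub, map_smul, smul_eq_mul, H.mean_q_mul_three, H.mean_x]
  ring

/-- The three kinds of products contribute `4`, `-4` and `4` times `κ₁ κ₃ μ`; the net coefficient is
non-zero, which determines `κ₃`. -/
theorem mean_conv_six (H : Expansion M J q qi x y κ v) :
    M (conv v 6) = M (algA2 J x y κ) + M (algA3 J x y κ v) - 4 * M (algA4 J x y κ)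
      + 4 * κ 1 * κ 3 * M (x * J (x * J y)) := by
  rw [H.conv_six]
  simp only [map_add, map_smul, smul_eq_mul, H.mean_one_mul_five, H.mean_two_mul_four,
    H.mean_three_mul_three]
  ring

theorem conv_eq_one (H : Expansion M J q qi x y κ v) {n : ℕ} (hn : 3 ≤ n) :
    conv v n = (2 * κ 1) • (q * v (n - 1)) +
      ∑ p ∈ Finset.Icc 2 (n - 2), v p * v (n - p) := by
  rw [conv, conv_succ_succ v n 1 le_rfl (by omega), H.one, smul_mul_assoc, smul_smul]

theorem conv_eq_two (H : Expansion M J q qi x y κ v) {n : ℕ} (hn : 5 ≤ n) :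
    conv v n = (2 * κ 1) • (q * v (n - 1)) + (2 : ℂ) • (v 2 * v (n - 2)) +
      ∑ p ∈ Finset.Icc 3 (n - 3), v p * v (n - p) := by
  rw [H.conv_eq_one (by omega), conv_succ_succ v n 2 (by norm_num) (by omega), add_assoc]

theorem conv_eq_three (H : Expansion M J q qi x y κ v) {n : ℕ} (hn : 7 ≤ n) :
    conv v n = (2 * κ 1) • (q * v (n - 1)) + (2 : ℂ) • (v 2 * v (n - 2)) +
      (2 : ℂ) • (v 3 * v (n - 3)) + ∑ p ∈ Finset.Icc 4 (n - 4), v p * v (n - p) := by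
  rw [H.conv_eq_two (by omega), conv_succ_succ v n 3 (by norm_num) (by omega)]
  abel

/-- Unrolling `v (n-1)`, `v (n-2)` and `v (n-3)` in turn, `κ (n-1)` meets `M x = 0` and `κ (n-2)`
meets `M (x * J x) = 0`. The constant `κ (n-3)` arises along two routes: through `x * J (x * J x)`,
of mean zero, and through `J (q * v 2)`, which gives `μ`. -/
theorem mean_one_mul (H : Expansion M J q qi x y κ v) {n : ℕ} (hn : 7 ≤ n) :
    κ 1 * M (q * v (n - 1)) =
      algR1 J x y κ v M n + 2 * κ 1 * M (x * J (x * J y)) * κ (n - 3) := by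
  rw [H.q_mul (by omega : 3 ≤ n - 1), H.conv_eq_two (by omega : 5 ≤ n - 1),
    show n - 1 - 1 = n - 2 by omega, show n - 1 - 2 = n - 3 by omega,
    show n - 1 - 3 = n - 4 by omega,
    H.q_mul (by omega : 3 ≤ n - 2), H.conv_eq_one (by omega : 3 ≤ n - 2),
    show n - 2 - 1 = n - 3 by omega, show n - 2 - 2 = n - 4 by omega,
    H.q_mul (by omega : 3 ≤ n - 3), H.two_mul_v (by omega : 3 ≤ n - 3)]
  have h2 := H.mean_x_prim_q_mul_two
  simp only [map_add, map_smul, mul_smul_comm, smul_eq_mul, mul_add, h2, smul_add, H.mean_x,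
    H.mean_xx, H.mean_xxx]
  rw [H.q_mul_two, algR1]
  simp only [conv, show n - 3 - 1 = n - 4 by omega, map_add, map_sub, map_smul, mul_smul_comm,
    smul_mul_assoc, smul_eq_mul, mul_add, mul_sub, add_mul, sub_mul, map_sum,
    Finset.mul_sum, Finset.sum_add_distrib, Finset.sum_sub_distrib]
  simp only [← Finset.mul_sum, mul_assoc]
  ring_nf
  simp only [Complex.I_sq, show Complex.I ^ 3 = -Complex.I by rw [pow_succ, Complex.I_sq]; ring]
  ring

theorem mean_two_mul (H : Expansion M J q qi x y κ v) {n : ℕ} (hn : 7 ≤ n) :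
    M (v 2 * v (n - 2)) =
      algR2 J x κ v M q n - 2 * κ 1 * M (x * J (x * J y)) * κ (n - 3) := by
  rw [H.two_mul_v (by omega : 3 ≤ n - 2), H.conv_eq_one (by omega : 3 ≤ n - 2),
    show n - 2 - 1 = n - 3 by omega, show n - 2 - 2 = n - 4 by omega,
    H.q_mul (by omega : 3 ≤ n - 3)]
  have h2 := H.mean_q_mul_two_prim_x
  simp only [map_add, map_smul, mul_smul_comm, smul_eq_mul, mul_add, h2, smul_add,
    H.mean_q_mul_two]
  simp only [algR2, conv, show n - 3 - 1 = n - 4 by omega, map_sum, Finset.mul_sum]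
  simp only [← Finset.mul_sum]
  ring_nf
  simp only [Complex.I_sq]
  ring

/-- Here `κ (n - 3)` multiplies `M (q * v 3) = 2 κ₁ μ`; the rest is put in the form `q⁻¹ v₃ l` of
the recursion by inserting `q * qi = 1`. -/
theorem mean_three_mul (H : Expansion M J q qi x y κ v) {n : ℕ} (hn : 7 ≤ n) :
    M (v 3 * v (n - 3)) = M (qi * v 3 * (Complex.I • (x * J (conv v (n - 3)))))
      + 2 * κ 1 * M (x * J (x * J y)) * κ (n - 3) := by
  rw [H.step (n - 3) (by omega)]
  have h : v 3 * (q * (Complex.I • J (conv v (n - 3)) + κ (n - 3) • 1)) =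
      qi * v 3 * (Complex.I • (x * J (conv v (n - 3)))) + κ (n - 3) • (q * v 3) := by
    rw [← H.sq]
    simp only [Algebra.smul_def, mul_one]
    linear_combination (-v 3 * algebraMap ℂ A Complex.I * q * J (conv v (n - 3))) * H.mul_inv
  rw [h, map_add, map_smul, smul_eq_mul, H.mean_q_mul_three]
  ring

/-- As at order 6, the coefficients `4`, `-4`, `4` of `κ₁ μ κ (n - 3)` add up to `4`. The bracket
involves only `v p` with `p ≤ n - 4`, so the secular condition at order `n` can be solved for `κ (n
- 3)`. -/
theorem mean_conv (H : Expansion M J q qi x y κ v) {n : ℕ} (hn : 7 ≤ n) :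
    M (conv v n) = 4 * κ 1 * M (x * J (x * J y)) * κ (n - 3) +
      (∑ p ∈ Finset.Icc 4 (n - 4), M (v p * v (n - p)) + 2 * algR1 J x y κ v M n
        + 2 * algR2 J x κ v M q n
        + 2 * M (qi * v 3 * (Complex.I • (x * J (conv v (n - 3)))))) := by
  have h1 := H.mean_one_mul hn
  rw [H.conv_eq_three hn]
  simp only [map_add, map_smul, smul_eq_mul, map_sum, H.mean_two_mul hn, H.mean_three_mul hn]
  linear_combination 2 * h1

end Expansion

end Algebra

/-! ### Identification of the concrete objects with the abstract expansion. -/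

section Link

variable {ω : ℝ} {f : ℝ → ℝ} {Q : PerAlg ω}

theorem norm_q (f : ℝ → ℝ) (t : ℝ) : ‖q f t‖ = 1 := by
  rw [q, mul_comm, Complex.norm_exp_ofReal_mul_I]

theorem q_mul_conj (f : ℝ → ℝ) (t : ℝ) : q f t * (starRingEnd ℂ) (q f t) = 1 := by
  rw [Complex.mul_conj, Complex.normSq_eq_norm_sq, norm_q]
  simp

theorem hasDerivAt_q (hf : Continuous f) (t : ℝ) :
    HasDerivAt (q f) (Complex.I * f t * q f t) t := by
  have h1 : HasDerivAt (fun t => ∫ τ in (0 : ℝ)..t, f τ) (f t) t :=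
    intervalIntegral.integral_hasDerivAt_right (hf.intervalIntegrable _ _)
      (hf.stronglyMeasurableAtFilter _ _) hf.continuousAt
  have h2 := (h1.ofReal_comp.const_mul Complex.I).cexp
  rw [mul_comm] at h2
  exact h2

theorem q_mul_cconj (hQ : (Q : ℝ → ℂ) = q f) : Q * cconj Q = 1 := by
  ext t
  simp [hQ, q_mul_conj]

theorem Q0_eq (hQ : (Q : ℝ → ℂ) = q f) : Q0 f = ((Q * Q : PerAlg ω) : ℝ → ℂ) := by
  funext t
  simp [Q0, hQ, sq]

theorem q_inv (hQ : (Q : ℝ → ℂ) = q f) (t : ℝ) : (q f t)⁻¹ = (cconj Q : ℝ → ℂ) t := by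
  rw [cconj_apply, hQ]
  exact inv_eq_of_mul_eq_one_right (q_mul_conj f t)

theorem Q0_inv (hQ : (Q : ℝ → ℂ) = q f) (t : ℝ) :
    (Q0 f t)⁻¹ = ((cconj Q * cconj Q : PerAlg ω) : ℝ → ℂ) t := by
  rw [Q0, ← inv_pow, q_inv hQ, PerAlg.mul_apply, sq]

theorem cconj_cconj (h : PerAlg ω) : cconj (cconj h) = h := by ext t; simp

variable [hω : Fact (0 < ω)]

theorem ren_pair (a b : PerAlg ω) :
    ren [(a : ℝ → ℂ), (b : ℝ → ℂ)] = ((a * prim ω b : PerAlg ω) : ℝ → ℂ) := by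
  funext t
  simp only [ren, mean_eq_avg, PerAlg.mul_apply, prim_apply]

theorem ren_cons (a b : ℝ → ℂ) (l : List (ℝ → ℂ)) (α β : PerAlg ω) (ha : a = α)
    (hb : ren (b :: l) = β) :
    ren (a :: b :: l) = ((α * prim ω β : PerAlg ω) : ℝ → ℂ) := by
  funext t
  simp only [ren, hb, ha, mean_eq_avg, PerAlg.mul_apply, prim_apply]

theorem ren_triple (a b c : PerAlg ω) :
    ren [(a : ℝ → ℂ), (b : ℝ → ℂ), (c : ℝ → ℂ)] =
      ((a * prim ω (b * prim ω c) : PerAlg ω) : ℝ → ℂ) :=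
  ren_cons _ _ _ _ _ rfl (ren_pair b c)

theorem ren_quadruple (a b c d : PerAlg ω) :
    ren [(a : ℝ → ℂ), (b : ℝ → ℂ), (c : ℝ → ℂ), (d : ℝ → ℂ)] =
      ((a * prim ω (b * prim ω (c * prim ω d)) : PerAlg ω) : ℝ → ℂ) :=
  ren_cons _ _ _ _ _ rfl (ren_triple b c d)

/-- The expansion coefficients, with the mean subtracted before each integration. -/
def pv (κ : ℕ → ℂ) (Q : PerAlg ω) : ℕ → PerAlg ω
  | 0 => 0
  | 1 => κ 1 • Q
  | 2 => Q * (Complex.I • prim ω (κ 1 ^ 2 • (Q * Q) - cconj Q * cconj Q) + κ 2 • 1)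
  | n + 3 => Q * (Complex.I • prim ω
      (∑ j : Fin (n + 2), pv κ Q (j + 1) * pv κ Q (n + 2 - j)) + κ (n + 3) • 1)
termination_by n => n
decreasing_by all_goals omega

theorem pv_eq (κ : ℕ → ℂ) (Q : PerAlg ω) (n : ℕ) (hn : 3 ≤ n) :
    pv κ Q n = Q * (Complex.I • prim ω (conv (pv κ Q) n) + κ n • 1) := by
  obtain ⟨k, rfl⟩ : ∃ k, n = k + 3 := ⟨n - 3, by omega⟩
  rw [pv, conv, Fin.sum_univ_eq_sum_range (fun j => pv κ Q (j + 1) * pv κ Q (k + 2 - j)) (k + 2),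
    Finset.range_eq_Ico, show Finset.Icc 1 (k + 3 - 1) = Finset.Ico (0 + 1) (k + 2 + 1) from by
      ext; simp, ← Finset.sum_Ico_add']
  simp only [show ∀ j, k + 3 - (j + 1) = k + 2 - j by intro j; omega]

/-- Mean zero of `f` means that its integral over a period vanishes, so the phase of `q` is itself
periodic. -/
theorem exists_perAlg_q (hf : Continuous f) (hper : Function.Periodic f (2 * Real.pi / ω))
    (hmean : mean (fun t => (f t : ℂ)) = 0) : ∃ Q : PerAlg ω, (Q : ℝ → ℂ) = q f := by
  let F : PerAlg ω := ⟨fun t => (f t : ℂ), Complex.continuous_ofReal.comp hf,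
    fun t => by simp only [hper t]⟩
  have hF : avg ω F = 0 := by rw [← mean_eq_avg]; exact hmean
  have h0 : ∫ τ in (0 : ℝ)..(2 * Real.pi / ω), f τ = 0 := by
    have h1 := integral_period F
    rw [hF, mul_zero] at h1
    have h2 : ∫ τ in (0 : ℝ)..(2 * Real.pi / ω), ((f τ : ℝ) : ℂ) = 0 := h1
    rw [intervalIntegral.integral_ofReal] at h2
    exact_mod_cast h2
  refine ⟨⟨q f, continuous_iff_continuousAt.2 fun t => (hasDerivAt_q hf t).continuousAt,
    fun t => ?_⟩, rfl⟩
  rw [q, q, ← intervalIntegral.integral_add_adjacent_intervals (hf.intervalIntegrable 0 t)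
    (hf.intervalIntegrable t _), hper.intervalIntegral_add_eq t 0, zero_add, h0, add_zero]

theorem Q1_eq (hQ : (Q : ℝ → ℂ) = q f) :
    Q1 f = ((Q * Q * prim ω (cconj Q * cconj Q) : PerAlg ω) : ℝ → ℂ) := by
  funext t
  simp only [Q1, Q0_inv hQ]
  simp only [mean_eq_avg, PerAlg.mul_apply (Q * Q), prim_apply, Q0_eq hQ]

theorem Q2_eq (hQ : (Q : ℝ → ℂ) = q f) :
    Q2 f = ((Q * Q * prim ω (Q * Q) : PerAlg ω) : ℝ → ℂ) := by
  funext t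
  simp only [Q2, mean_eq_avg, PerAlg.mul_apply (Q * Q), prim_apply, Q0_eq hQ]

theorem Q3_eq (hQ : (Q : ℝ → ℂ) = q f) :
    Q3 f = ((Q * Q * prim ω (Q * Q * prim ω (cconj Q * cconj Q)) : PerAlg ω) : ℝ → ℂ) := by
  funext t
  simp only [Q3, Q1_eq hQ, mean_eq_avg, PerAlg.mul_apply (Q * Q), prim_apply, Q0_eq hQ]

theorem expansion_pv (hQ : (Q : ℝ → ℂ) = q f) (hIII : ConditionIII f) (κ : ℕ → ℂ) :
    Expansion (avg ω) (prim ω) Q (cconj Q) (Q * Q) (cconj Q * cconj Q) κ (pv κ Q) where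
  parts := avg_mul_prim
  prim_mul _ _ := prim_mul_prim
  mul_inv := q_mul_cconj hQ
  sq := rfl
  inv_sq := rfl
  mean_x := by rw [← mean_eq_avg, ← Q0_eq hQ]; exact hIII.1
  mean_y := by
    rw [← cconj_mul, avg_cconj, ← mean_eq_avg, ← Q0_eq hQ, hIII.1, map_zero]
  mean_xy := by rw [← mean_eq_avg, ← Q1_eq hQ]; exact hIII.2.1
  one := by rw [pv]
  two := by rw [pv]
  step n hn := pv_eq κ Q n hn

theorem v_one_eq (hQ : (Q : ℝ → ℂ) = q f) (κ : ℕ → ℂ) : v f κ 1 = (pv κ Q 1 : ℝ → ℂ) := by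
  funext t
  rw [v, pv, PerAlg.smul_apply, hQ]

theorem v_two_eq (hQ : (Q : ℝ → ℂ) = q f) (hIII : ConditionIII f) (κ : ℕ → ℂ) :
    v f κ 2 = (pv κ Q 2 : ℝ → ℂ) := by
  funext t
  have H := expansion_pv hQ hIII κ
  have h0 : avg ω (κ 1 ^ 2 • (Q * Q) - cconj Q * cconj Q) = 0 := by
    rw [map_sub, map_smul, H.mean_x, H.mean_y]; simp
  rw [v, pv, PerAlg.mul_apply, PerAlg.add_apply, PerAlg.smul_apply, PerAlg.smul_apply, prim_apply,
    h0, hQ]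
  simp only [Q0_inv hQ]
  simp only [Q0_eq hQ, PerAlg.one_apply, mul_one, sub_zero, PerAlg.sub_apply,
    PerAlg.smul_apply]

/-- When the integrand has mean zero, subtracting its mean changes nothing. -/
theorem v_eq_pv_of_lt (hQ : (Q : ℝ → ℂ) = q f) (κ : ℕ → ℂ) {n : ℕ} (hn : 3 ≤ n)
    (hlt : ∀ p, 1 ≤ p → p < n → v f κ p = (pv κ Q p : ℝ → ℂ))
    (h0 : avg ω (conv (pv κ Q) n) = 0) : v f κ n = (pv κ Q n : ℝ → ℂ) := by
  funext t
  rw [v_eq f κ n hn, pv_eq κ Q n hn, PerAlg.mul_apply, PerAlg.add_apply, PerAlg.smul_apply,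
    PerAlg.smul_apply, prim_apply, h0, hQ, PerAlg.one_apply, mul_one]
  congr 4
  funext τ
  rw [sub_zero, conv, PerAlg.sum_apply]
  refine Finset.sum_congr rfl fun p hp => ?_
  rw [Finset.mem_Icc] at hp
  rw [hlt p hp.1 (by omega), hlt (n - p) (by omega) (by omega), PerAlg.mul_apply]

theorem vv_eq {κ : ℕ → ℂ} {p r : ℕ} (hp : v f κ p = (pv κ Q p : ℝ → ℂ))
    (hr : v f κ r = (pv κ Q r : ℝ → ℂ)) :
    vv f κ p r = ((pv κ Q p * pv κ Q r : PerAlg ω) : ℝ → ℂ) := by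
  funext t
  rw [vv, hp, hr, PerAlg.mul_apply]

theorem s_eq (hQ : (Q : ℝ → ℂ) = q f) (κ : ℕ → ℂ) :
    s f κ = ((-(Q * Q * (κ 1 ^ 2 • prim ω (Q * Q) - prim ω (cconj Q * cconj Q)) ^ 2) : PerAlg ω) :
      ℝ → ℂ) := by
  funext t
  have h := q_mul_conj f t
  simp only [s, Q0_inv hQ, Q1_eq hQ, Q2_eq hQ, PerAlg.mul_apply, PerAlg.neg_apply,
    PerAlg.pow_apply, PerAlg.sub_apply, PerAlg.smul_apply, cconj_apply, hQ]
  generalize (prim ω (Q * Q) : ℝ → ℂ) t = X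
  generalize (prim ω (cconj Q * cconj Q) : ℝ → ℂ) t = Y
  generalize (starRingEnd ℂ) (q f t) = z at *
  linear_combination (-(q f t) ^ 2 * (κ 1 ^ 2 * X - Y) ^ 2 * (q f t * z + 1)) * h

theorem A1_eq (hQ : (Q : ℝ → ℂ) = q f) (κ : ℕ → ℂ) :
    A1 f κ = ((algA1 (prim ω) (Q * Q) (cconj Q * cconj Q) κ : PerAlg ω) : ℝ → ℂ) := by
  funext t
  simp only [A1, algA1, Q0_eq hQ, Q1_eq hQ, Q2_eq hQ, s_eq hQ, ren_pair, ren_triple,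
    PerAlg.add_apply, PerAlg.smul_apply]

theorem A2_eq (hQ : (Q : ℝ → ℂ) = q f) (κ : ℕ → ℂ) :
    A2 f κ = ((algA2 (prim ω) (Q * Q) (cconj Q * cconj Q) κ : PerAlg ω) : ℝ → ℂ) := by
  funext t
  simp only [A2, algA2, Q0_eq hQ, Q1_eq hQ, Q2_eq hQ, A1_eq hQ, ren_pair, ren_triple,
    PerAlg.add_apply, PerAlg.sub_apply, PerAlg.smul_apply]

theorem A3_eq (hQ : (Q : ℝ → ℂ) = q f) (hIII : ConditionIII f) (κ : ℕ → ℂ) :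
    A3 f κ = ((algA3 (prim ω) (Q * Q) (cconj Q * cconj Q) κ (pv κ Q) : PerAlg ω) : ℝ → ℂ) := by
  have h2 := v_two_eq hQ hIII κ
  funext t
  simp only [A3, algA3, Q0_eq hQ, Q1_eq hQ, Q2_eq hQ, vv_eq h2 h2, ren_pair, ren_triple,
    PerAlg.add_apply, PerAlg.sub_apply, PerAlg.smul_apply]

theorem A4_eq (hQ : (Q : ℝ → ℂ) = q f) (κ : ℕ → ℂ) :
    A4 f κ = ((algA4 (prim ω) (Q * Q) (cconj Q * cconj Q) κ : PerAlg ω) : ℝ → ℂ) := by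
  funext t
  rw [A4, algA4, PerAlg.mul_apply (cconj Q * cconj Q), Q0_inv hQ]
  simp only [Q0_eq hQ, Q1_eq hQ, Q2_eq hQ, ren_pair, PerAlg.pow_apply,
    PerAlg.add_apply, PerAlg.sub_apply, PerAlg.smul_apply]

theorem R1_eq (hQ : (Q : ℝ → ℂ) = q f) (κ : ℕ → ℂ) {n : ℕ}
    (hlt : ∀ p, 1 ≤ p → p + 3 < n → v f κ p = (pv κ Q p : ℝ → ℂ)) :
    R1 f κ n = algR1 (prim ω) (Q * Q) (cconj Q * cconj Q) κ (pv κ Q) (avg ω) n := by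
  rw [R1, algR1]
  refine congrArg₂ (· + ·) (congrArg₂ (· - ·) (congrArg _ ?_) (congrArg _ ?_)) (congrArg _ ?_)
  · refine Finset.sum_congr rfl fun p hp => ?_
    rw [Finset.mem_Icc] at hp
    rw [vv_eq (hlt p (by omega) (by omega)) (hlt (n - 3 - p) (by omega) (by omega))]
    simp only [Q0_eq hQ, Q1_eq hQ, Q2_eq hQ, ren_triple, ren_quadruple, mean_eq_avg]
  · refine Finset.sum_congr rfl fun p hp => ?_
    rw [Finset.mem_Icc] at hp
    rw [vv_eq (hlt p (by omega) (by omega)) (hlt (n - 2 - p) (by omega) (by omega))]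
    simp only [Q0_eq hQ, ren_triple, mean_eq_avg]
  · refine Finset.sum_congr rfl fun p hp => ?_
    rw [Finset.mem_Icc] at hp
    rw [vv_eq (hlt p (by omega) (by omega)) (hlt (n - 1 - p) (by omega) (by omega))]
    simp only [Q0_eq hQ, ren_pair, mean_eq_avg]

theorem R2_eq (hQ : (Q : ℝ → ℂ) = q f) (hIII : ConditionIII f) (κ : ℕ → ℂ) {n : ℕ}
    (hlt : ∀ p, 1 ≤ p → p + 3 < n → v f κ p = (pv κ Q p : ℝ → ℂ)) :
    R2 f κ n = algR2 (prim ω) (Q * Q) κ (pv κ Q) (avg ω) Q n := by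
  have h2 : (fun t => q f t * v f κ 2 t) = ((Q * pv κ Q 2 : PerAlg ω) : ℝ → ℂ) := by
    funext t
    rw [v_two_eq hQ hIII κ, PerAlg.mul_apply, hQ]
  rw [R2, algR2, h2]
  refine congrArg₂ (· + ·) (congrArg _ ?_) (congrArg _ ?_)
  · refine Finset.sum_congr rfl fun p hp => ?_
    rw [Finset.mem_Icc] at hp
    rw [vv_eq (hlt p (by omega) (by omega)) (hlt (n - 3 - p) (by omega) (by omega))]
    simp only [Q0_eq hQ, ren_triple, mean_eq_avg]
  · refine Finset.sum_congr rfl fun p hp => ?_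
    rw [Finset.mem_Icc] at hp
    rw [vv_eq (hlt p (by omega) (by omega)) (hlt (n - 2 - p) (by omega) (by omega))]
    simp only [ren_pair, mean_eq_avg]

theorem l_eq (hQ : (Q : ℝ → ℂ) = q f) (κ : ℕ → ℂ) {n : ℕ}
    (hlt : ∀ p, 1 ≤ p → p < n → v f κ p = (pv κ Q p : ℝ → ℂ))
    (h0 : avg ω (conv (pv κ Q) n) = 0) :
    l f κ n = ((Complex.I • (Q * Q * prim ω (conv (pv κ Q) n)) : PerAlg ω) : ℝ → ℂ) := by
  funext t
  rw [l, PerAlg.smul_apply, PerAlg.mul_apply, prim_apply, h0, PerAlg.mul_apply, hQ, mul_assoc, sq]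
  congr 4
  funext τ
  rw [sub_zero, conv, PerAlg.sum_apply]
  refine Finset.sum_congr rfl fun p hp => ?_
  rw [Finset.mem_Icc] at hp
  rw [hlt p hp.1 (by omega), hlt (n - p) (by omega) (by omega), PerAlg.mul_apply]

theorem mean_Q3_eq (hQ : (Q : ℝ → ℂ) = q f) :
    mean (Q3 f) = avg ω (Q * Q * prim ω (Q * Q * prim ω (cconj Q * cconj Q))) := by
  rw [Q3_eq hQ, mean_eq_avg]

/-- Since `|q| = 1`, conjugation exchanges `x` and `y`, and it commutes with `prim` and `avg`. -/
theorem conj_mean_Q3_eq (hQ : (Q : ℝ → ℂ) = q f) :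
    (starRingEnd ℂ) (mean (Q3 f)) =
      avg ω (cconj Q * cconj Q * prim ω (cconj Q * cconj Q * prim ω (Q * Q))) := by
  rw [mean_Q3_eq hQ, ← avg_cconj, cconj_mul, cconj_mul, ← prim_cconj, cconj_mul, cconj_mul,
    ← prim_cconj, cconj_mul, cconj_cconj]

theorem IsSecularChoice.kappa_one_ne_zero {κ : ℕ → ℂ} (hκ : IsSecularChoice f κ)
    (hIII : ConditionIII f) : κ 1 ≠ 0 := by
  intro h
  have := hκ.kappa_one
  rw [h, eq_comm] at this
  simp [hIII.2.2] at this

/-- The recursion for the constants in terms of the periodic expansion coefficients. -/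
theorem IsSecularChoice.kappa_rec_eq {κ : ℕ → ℂ} (hκ : IsSecularChoice f κ)
    (hQ : (Q : ℝ → ℂ) = q f) (hIII : ConditionIII f) {n : ℕ} (hn : 7 ≤ n)
    (hlt : ∀ p, 1 ≤ p → p + 3 < n → v f κ p = (pv κ Q p : ℝ → ℂ))
    (h0 : avg ω (conv (pv κ Q) (n - 3)) = 0) :
    κ (n - 3) = -1 / (4 * κ 1 * mean (Q3 f)) *
      (∑ p ∈ Finset.Icc 4 (n - 4), avg ω (pv κ Q p * pv κ Q (n - p))
        + 2 * algR1 (prim ω) (Q * Q) (cconj Q * cconj Q) κ (pv κ Q) (avg ω) n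
        + 2 * algR2 (prim ω) (Q * Q) κ (pv κ Q) (avg ω) Q n
        + 2 * avg ω (cconj Q * pv κ Q 3 *
          (Complex.I • (Q * Q * prim ω (conv (pv κ Q) (n - 3)))))) := by
  have h1 : (fun t => (q f t)⁻¹ * v f κ 3 t * l f κ (n - 3) t) =
      ((cconj Q * pv κ Q 3 * (Complex.I • (Q * Q * prim ω (conv (pv κ Q) (n - 3)))) : PerAlg ω) :
        ℝ → ℂ) := by
    funext t
    rw [l_eq hQ κ (fun p h1 h2 => hlt p h1 (by omega)) h0, q_inv hQ,
      hlt 3 (by norm_num) (by omega), PerAlg.mul_apply, PerAlg.mul_apply]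
  have h2 : ∑ p ∈ Finset.Icc 4 (n - 4), mean (vv f κ p (n - p)) =
      ∑ p ∈ Finset.Icc 4 (n - 4), avg ω (pv κ Q p * pv κ Q (n - p)) := by
    refine Finset.sum_congr rfl fun p hp => ?_
    rw [Finset.mem_Icc] at hp
    rw [vv_eq (hlt p (by omega) (by omega)) (hlt (n - p) (by omega) (by omega)), mean_eq_avg]
  rw [hκ.kappa_rec n hn, R1_eq hQ κ hlt, R2_eq hQ hIII κ hlt, h1, h2, mean_eq_avg]

/-- The choice of constants eliminates the secular terms. -/
theorem IsSecularChoice.v_eq_pv {κ : ℕ → ℂ} (hκ : IsSecularChoice f κ)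
    (hQ : (Q : ℝ → ℂ) = q f) (hIII : ConditionIII f) (n : ℕ) (hn : 1 ≤ n) :
    v f κ n = (pv κ Q n : ℝ → ℂ) ∧ (3 ≤ n → avg ω (conv (pv κ Q) n) = 0) := by
  induction n using Nat.strong_induction_on with
  | _ n ih =>
    have H := expansion_pv hQ hIII κ
    have hμ := hIII.2.2
    have hκ1 := hκ.kappa_one_ne_zero hIII
    have h0 : 3 ≤ n → avg ω (conv (pv κ Q) n) = 0 := fun h3 => by
      obtain rfl | rfl | rfl | rfl | h7 : n = 3 ∨ n = 4 ∨ n = 5 ∨ n = 6 ∨ 7 ≤ n := by omega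
      · exact H.mean_conv_three
      · rw [H.mean_conv_four, ← mean_Q3_eq hQ, ← conj_mean_Q3_eq hQ, hκ.kappa_one]
        field_simp
        ring
      · rw [H.mean_conv_five, ← mean_Q3_eq hQ, ← mean_eq_avg (algA1 _ _ _ _), ← A1_eq hQ,
          hκ.kappa_two]
        field_simp
        rw [Complex.I_sq]
        ring
      · rw [H.mean_conv_six, ← mean_Q3_eq hQ, ← mean_eq_avg (algA2 _ _ _ _),
          ← mean_eq_avg (algA3 _ _ _ _ _), ← mean_eq_avg (algA4 _ _ _ _), ← A2_eq hQ,
          ← A3_eq hQ hIII, ← A4_eq hQ, hκ.kappa_three]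
        field_simp
        ring
      -- The formula for `κ (n - 3)` contains `l (n - 3)`, which has no subtracted mean; it is
      -- periodic because the secular condition already holds at order `n - 3`.
      · have hk := hκ.kappa_rec_eq hQ hIII h7
          (fun p h1 h2 => (ih p (by omega) h1).1)
          ((ih (n - 3) (by omega) (by omega)).2 (by omega))
        rw [H.mean_conv h7, ← mean_Q3_eq hQ, hk]
        field_simp
        ring
    refine ⟨?_, h0⟩
    obtain rfl | rfl | h3 : n = 1 ∨ n = 2 ∨ 3 ≤ n := by omega
    · exact v_one_eq hQ κ
    · exact v_two_eq hQ hIII κ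
    · exact v_eq_pv_of_lt hQ κ h3 (fun p h1 h2 => (ih p h2 h1).1) (h0 h3)

end Link

/-! ### Existence of the constants. -/

/-- Course-of-values recursion. -/
theorem exists_eq_of_depends_below {α : Type*} [Zero α] (F : ℕ → (ℕ → α) → α)
    (hF : ∀ n κ κ', (∀ m < n, κ m = κ' m) → F n κ = F n κ') : ∃ κ : ℕ → α, ∀ n, κ n = F n κ := by
  let G : (n : ℕ) → ((m : ℕ) → m < n → α) → α :=
    -- The value `0` at and above `n` is a filler which, by `hF`, cannot affect `F n`.
    fun n ih => F n fun m => if h : m < n then ih m h else 0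
  refine ⟨Nat.lt_wfRel.wf.fix G, fun n => ?_⟩
  rw [WellFounded.fix_eq]
  refine hF _ _ _ fun m hm => ?_
  rw [dif_pos hm]

theorem v_congr (f : ℝ → ℝ) {κ κ' : ℕ → ℂ} (n : ℕ) (h : ∀ m, 1 ≤ m → m ≤ n → κ m = κ' m) :
    v f κ n = v f κ' n := by
  induction n using Nat.strong_induction_on with
  | _ n ih =>
    obtain rfl | rfl | rfl | h3 : n = 0 ∨ n = 1 ∨ n = 2 ∨ 3 ≤ n := by omega
    · simp only [v]
    · simp only [v, h 1 le_rfl le_rfl]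
    · simp only [v, h 1 le_rfl (by norm_num), h 2 (by norm_num) le_rfl]
    · funext t
      rw [v_eq f κ n h3, v_eq f κ' n h3, h n (by omega) le_rfl]
      congr 4
      funext τ
      refine Finset.sum_congr rfl fun p hp => ?_
      rw [Finset.mem_Icc] at hp
      rw [ih p (by omega) fun m h1 h2 => h m h1 (by omega),
        ih (n - p) (by omega) fun m h1 h2 => h m h1 (by omega)]

theorem vv_congr (f : ℝ → ℝ) {κ κ' : ℕ → ℂ} {N : ℕ} (h : ∀ m, m < N → κ m = κ' m) {p r : ℕ}
    (hp : p < N) (hr : r < N) : vv f κ p r = vv f κ' p r := by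
  funext t
  rw [vv, vv, v_congr f p fun m _ h2 => h m (by omega), v_congr f r fun m _ h2 => h m (by omega)]

theorem A1_congr (f : ℝ → ℝ) {κ κ' : ℕ → ℂ} (h1 : κ 1 = κ' 1) : A1 f κ = A1 f κ' := by
  have hs : s f κ = s f κ' := by funext t; simp only [s, h1]
  funext t
  simp only [A1, h1, hs]

theorem A2_congr (f : ℝ → ℝ) {κ κ' : ℕ → ℂ} (h1 : κ 1 = κ' 1) (h2 : κ 2 = κ' 2) :
    A2 f κ = A2 f κ' := by
  funext t
  simp only [A2, h1, h2, A1_congr f h1]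

theorem A3_congr (f : ℝ → ℝ) {κ κ' : ℕ → ℂ} (h : ∀ m, m < 3 → κ m = κ' m) :
    A3 f κ = A3 f κ' := by
  funext t
  simp only [A3, h 1 (by norm_num), h 2 (by norm_num),
    vv_congr f h (by norm_num : 2 < 3) (by norm_num : 2 < 3)]

theorem A4_congr (f : ℝ → ℝ) {κ κ' : ℕ → ℂ} (h1 : κ 1 = κ' 1) (h2 : κ 2 = κ' 2) :
    A4 f κ = A4 f κ' := by
  funext t
  simp only [A4, h1, h2]

theorem l_congr (f : ℝ → ℝ) {κ κ' : ℕ → ℂ} {n : ℕ} (h : ∀ m, m < n → κ m = κ' m) :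
    l f κ n = l f κ' n := by
  funext t
  rw [l, l]
  congr 2
  funext τ
  refine Finset.sum_congr rfl fun p hp => ?_
  rw [Finset.mem_Icc] at hp
  rw [v_congr f p fun m _ h2 => h m (by omega), v_congr f (n - p) fun m _ h2 => h m (by omega)]

/-- Both indices of each product stay below `n - 3`, the index being defined. This is why the
recursion is not circular. -/
theorem R1_congr (f : ℝ → ℝ) {κ κ' : ℕ → ℂ} {n : ℕ} (hn : 7 ≤ n)
    (h : ∀ m, m < n - 3 → κ m = κ' m) : R1 f κ n = R1 f κ' n := by
  have hv : ∀ p r, 1 ≤ p → p + r < n → r < n - 3 → p < n - 3 → vv f κ p r = vv f κ' p r :=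
    fun p r _ _ h1 h2 => vv_congr f h h2 h1
  rw [R1, R1, h 1 (by omega), h 2 (by omega)]
  refine congrArg₂ (· + ·) (congrArg₂ (· - ·) (congrArg _ ?_) (congrArg _ ?_)) (congrArg _ ?_) <;>
  · refine Finset.sum_congr rfl fun p hp => ?_
    rw [Finset.mem_Icc] at hp
    rw [hv _ _ (by omega) (by omega) (by omega) (by omega)]

theorem R2_congr (f : ℝ → ℝ) {κ κ' : ℕ → ℂ} {n : ℕ} (hn : 7 ≤ n)
    (h : ∀ m, m < n - 3 → κ m = κ' m) : R2 f κ n = R2 f κ' n := by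
  have hv : ∀ p r, 1 ≤ p → p + r < n → r < n - 3 → p < n - 3 → vv f κ p r = vv f κ' p r :=
    fun p r _ _ h1 h2 => vv_congr f h h2 h1
  rw [R2, R2, h 1 (by omega), v_congr f 2 fun m _ h2 => h m (by omega)]
  refine congrArg₂ (· + ·) (congrArg _ ?_) (congrArg _ ?_) <;>
  · refine Finset.sum_congr rfl fun p hp => ?_
    rw [Finset.mem_Icc] at hp
    rw [hv _ _ (by omega) (by omega) (by omega) (by omega)]

/-- A square root exists in `ℂ`, and each further right-hand side reads only smaller indices. The
branch `n + 4` of `F` is the rule for order `n + 7`. -/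
theorem exists_isSecularChoice (f : ℝ → ℝ) : ∃ κ : ℕ → ℂ, IsSecularChoice f κ := by
  obtain ⟨z, hz⟩ := IsAlgClosed.exists_pow_nat_eq
    ((starRingEnd ℂ) (mean (Q3 f)) / mean (Q3 f)) (by norm_num : 0 < 2)
  let F : ℕ → (ℕ → ℂ) → ℂ := fun n κ => match n with
    | 0 => 0
    | 1 => z
    | 2 => -(Complex.I * mean (A1 f κ)) / (2 * mean (Q3 f))
    | 3 => (4 * mean (A4 f κ) - mean (A3 f κ) - mean (A2 f κ)) / (4 * κ 1 * mean (Q3 f))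
    | n + 4 => -1 / (4 * κ 1 * mean (Q3 f)) *
        (∑ p ∈ Finset.Icc 4 (n + 7 - 4), mean (vv f κ p (n + 7 - p))
          + 2 * R1 f κ (n + 7) + 2 * R2 f κ (n + 7)
          + 2 * mean (fun t => (q f t)⁻¹ * v f κ 3 t * l f κ (n + 7 - 3) t))
  obtain ⟨κ, hκ⟩ := exists_eq_of_depends_below F (by
    intro n κ κ' h
    match n with
    | 0 => rfl
    | 1 => rfl
    | 2 => simp only [F, A1_congr f (h 1 (by norm_num))]
    | 3 =>
      simp only [F, A2_congr f (h 1 (by norm_num)) (h 2 (by norm_num)), A3_congr f h,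
        A4_congr f (h 1 (by norm_num)) (h 2 (by norm_num)), h 1 (by norm_num)]
    | n + 4 =>
      have hsum : ∑ p ∈ Finset.Icc 4 (n + 7 - 4), mean (vv f κ p (n + 7 - p)) =
          ∑ p ∈ Finset.Icc 4 (n + 7 - 4), mean (vv f κ' p (n + 7 - p)) := by
        refine Finset.sum_congr rfl fun p hp => ?_
        rw [Finset.mem_Icc] at hp
        rw [vv_congr f h (by omega) (by omega)]
      simp only [F, hsum, R1_congr f (by omega : 7 ≤ n + 7) h, R2_congr f (by omega : 7 ≤ n + 7) h,
        h 1 (by omega), v_congr f 3 fun m _ h2 => h m (by omega),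
        l_congr f (n := n + 7 - 3) h])
  refine ⟨κ, ?_, hκ 2, hκ 3, fun n hn => ?_⟩
  · rw [hκ 1]
    exact hz
  · obtain ⟨m, rfl⟩ : ∃ m, n = m + 7 := ⟨n - 7, by omega⟩
    exact hκ (m + 4)

/-! ### Fourier coefficients of periodic functions. -/

section Fourier

/-- The Fourier mode `t ↦ exp (i m ω t)`. -/
def mode (ω : ℝ) [hω : Fact (0 < ω)] (m : ℤ) : PerAlg ω :=
  ⟨fun t => Complex.exp (Complex.I * m * ω * t), by fun_prop, fun t => by
    have h : (ω : ℂ) ≠ 0 := by exact_mod_cast hω.out.ne'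
    rw [Complex.exp_eq_exp_iff_exists_int]
    refine ⟨m, ?_⟩
    push_cast
    field_simp⟩

variable {ω : ℝ} [hω : Fact (0 < ω)]

theorem mode_apply (m : ℤ) (t : ℝ) :
    (mode ω m : ℝ → ℂ) t = Complex.exp (Complex.I * m * ω * t) := rfl

theorem mode_zero : mode ω 0 = 1 := by ext t; simp [mode_apply]

theorem mode_add (m n : ℤ) : mode ω (m + n) = mode ω m * mode ω n := by
  ext t
  rw [PerAlg.mul_apply, mode_apply, mode_apply, mode_apply, ← Complex.exp_add]
  push_cast
  ring_nf

theorem norm_mode_apply (m : ℤ) (t : ℝ) : ‖(mode ω m : ℝ → ℂ) t‖ = 1 := by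
  rw [mode_apply, show Complex.I * m * ω * t = ((m * ω * t : ℝ) : ℂ) * Complex.I by
    push_cast; ring, Complex.norm_exp_ofReal_mul_I]

theorem hasDerivAt_mode (m : ℤ) (t : ℝ) :
    HasDerivAt (mode ω m : ℝ → ℂ) (Complex.I * m * ω * (mode ω m : ℝ → ℂ) t) t := by
  have h1 := ((Complex.ofRealCLM.hasDerivAt (x := t)).const_mul (Complex.I * m * ω)).cexp
  refine h1.congr_deriv ?_
  simp [mode_apply, mul_comm]

theorem freq_ne_zero {m : ℤ} (hm : m ≠ 0) : Complex.I * m * ω ≠ 0 :=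
  mul_ne_zero (mul_ne_zero Complex.I_ne_zero (by exact_mod_cast hm))
    (by exact_mod_cast hω.out.ne')

theorem avg_mode_and_prim_mode {m : ℤ} (hm : m ≠ 0) :
    avg ω (mode ω m) = 0 ∧ prim ω (mode ω m) = (Complex.I * m * ω)⁻¹ • (mode ω m - 1) := by
  have hc := freq_ne_zero (ω := ω) hm
  have := eq_prim_of_hasDerivAt (h := mode ω m - 1) (k := (Complex.I * m * ω) • mode ω m)
    (by simp [mode_apply]) fun t =>
      (hasDerivAt_mode (ω := ω) m t).sub_const 1
  rw [map_smul, map_smul, smul_eq_mul] at this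
  refine ⟨(mul_eq_zero.1 this.1).resolve_left hc, ?_⟩
  rw [this.2, smul_smul, inv_mul_cancel₀ hc, one_smul]

/-- The `m`-th Fourier coefficient. -/
def fc (m : ℤ) (h : PerAlg ω) : ℂ := avg ω (mode ω (-m) * h)

theorem fc_add (m : ℤ) (h k : PerAlg ω) : fc m (h + k) = fc m h + fc m k := by
  simp only [fc, mul_add, map_add]

theorem fc_smul (m : ℤ) (c : ℂ) (h : PerAlg ω) : fc m (c • h) = c * fc m h := by
  simp only [fc, mul_smul_comm, map_smul, smul_eq_mul]

theorem fc_zero (h : PerAlg ω) : fc 0 h = avg ω h := by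
  rw [fc, neg_zero, mode_zero, one_mul]

theorem fc_mode_mul (m j : ℤ) (h : PerAlg ω) : fc m (mode ω j * h) = fc (m - j) h := by
  rw [fc, fc, ← mul_assoc, ← mode_add, neg_sub, sub_eq_neg_add]

theorem fc_cconj (m : ℤ) (h : PerAlg ω) : fc m (cconj h) = (starRingEnd ℂ) (fc (-m) h) := by
  rw [fc, fc, ← avg_cconj, cconj_mul]
  congr 2
  ext t
  simp only [mode_apply, cconj_apply, ← Complex.exp_conj, map_mul, Complex.conj_I,
    Complex.conj_ofReal, map_intCast]
  push_cast
  ring_nf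

/-- Integration by parts against `mode ω (-m)`, whose primitive is explicit; the terms containing
`avg ω h` cancel. -/
theorem fc_prim {m : ℤ} (hm : m ≠ 0) (h : PerAlg ω) :
    fc m (prim ω h) = fc m h / (Complex.I * m * ω) := by
  have hc := freq_ne_zero (ω := ω) hm
  obtain ⟨h1, h2⟩ := avg_mode_and_prim_mode (ω := ω) (neg_ne_zero.2 hm)
  have h3 := avg_mul_prim h (mode ω (-m))
  rw [h1, h2, mul_comm (prim ω h), mul_comm h] at h3
  simp only [smul_mul_assoc, sub_mul, one_mul, map_smul, map_sub, h1, avg_one, smul_eq_mul] at h3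
  rw [fc, fc, eq_div_iff hc]
  push_cast at h3
  rw [show Complex.I * -(m : ℂ) * ω = -(Complex.I * m * ω) by ring, inv_neg] at h3
  generalize Complex.I * (m : ℂ) * ω = c at *
  field_simp at h3
  linear_combination h3

theorem coef_eq_fc (h : PerAlg ω) (m : ℤ) : coef hω.out (h : ℝ → ℂ) m = fc m h := by
  have h1 := hω.out
  have h2 := Real.pi_pos
  have h3 : (ω : ℂ) ≠ 0 := by exact_mod_cast h1.ne'
  have h4 : (Real.pi : ℂ) ≠ 0 := by exact_mod_cast h2.ne'
  rw [coef, fourierCoeffOn_eq_integral, fc, avg_apply, Complex.real_smul]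
  congr 1
  · congr 1
    field_simp
    simp
  · congr 1
    funext t
    rw [fourier_coe_apply, PerAlg.mul_apply, mode_apply, smul_eq_mul]
    congr 2
    push_cast
    rw [sub_zero]
    field_simp

/-- The function descends to a continuous function on the circle, where absolute summability of the
coefficients gives pointwise convergence. -/
theorem hasSum_fc (h : PerAlg ω) (hs : Summable fun m => ‖fc m h‖) (t : ℝ) :
    HasSum (fun m => fc m h * (mode ω m : ℝ → ℂ) t) ((h : ℝ → ℂ) t) := by
  have h1 := hω.out
  have h2 := Real.pi_pos
  have h3 : (ω : ℂ) ≠ 0 := by exact_mod_cast h1.ne'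
  have h4 : (Real.pi : ℂ) ≠ 0 := by exact_mod_cast h2.ne'
  have : Fact (0 < 2 * Real.pi / ω) := ⟨by positivity⟩
  let F : C(AddCircle (2 * Real.pi / ω), ℂ) :=
    ⟨(PerAlg.periodic h).lift, continuous_coinduced_dom.2 (PerAlg.continuous h)⟩
  have hF : ∀ x : ℝ, F (x : AddCircle (2 * Real.pi / ω)) = (h : ℝ → ℂ) x :=
    fun x => (PerAlg.periodic h).lift_coe x
  have hc : ∀ m, fourierCoeff F m = fc m h := fun m => by
    rw [fourierCoeff_eq_intervalIntegral _ _ 0, fc, avg_apply, Complex.real_smul, zero_add]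
    congr 1
    · congr 1
      field_simp
    · congr 1
      funext t
      rw [hF, fourier_coe_apply, PerAlg.mul_apply, mode_apply, smul_eq_mul]
      congr 2
      push_cast
      field_simp
  have h5 := has_pointwise_sum_fourier_series_of_summable (f := F)
    (by rw [show fourierCoeff F = fun m => fc m h from funext hc]; exact hs.of_norm) t
  rw [hF] at h5
  convert h5 using 2 with m
  rw [hc, fourier_coe_apply, smul_eq_mul, mode_apply]
  congr 2
  push_cast
  field_simp

/-- Only `h` is expanded: its absolutely convergent series is integrated termwise against `mode ω
(-m) * k`, with `k` merely bounded. -/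
theorem hasSum_fc_mul (h k : PerAlg ω) (hs : Summable fun m => ‖fc m h‖) (m : ℤ) :
    HasSum (fun j => fc j h * fc (m - j) k) (fc m (h * k)) := by
  obtain ⟨B, hB⟩ : ∃ B, ∀ t, ‖(k : ℝ → ℂ) t‖ ≤ B := by
    have hT : 0 < 2 * Real.pi / ω := by have := hω.out; have := Real.pi_pos; positivity
    obtain ⟨B, hB⟩ := ((PerAlg.periodic k).compact_of_continuous hT.ne'
      (PerAlg.continuous k)).isBounded.exists_norm_le
    exact ⟨B, fun t => hB _ ⟨t, rfl⟩⟩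
  have key : HasSum (fun j => ∫ t in (0 : ℝ)..(2 * Real.pi / ω),
      (fc j h • (mode ω (-m) * (mode ω j * k)) : ℝ → ℂ) t)
      (∫ t in (0 : ℝ)..(2 * Real.pi / ω), ((mode ω (-m) * (h * k) : PerAlg ω) : ℝ → ℂ) t) := by
    refine intervalIntegral.hasSum_integral_of_dominated_convergence
      (fun j _ => ‖fc j h‖ * B) (fun j => ?_) (fun j => ?_) ?_ ?_ ?_
    · exact (PerAlg.continuous (fc j h • (mode ω (-m) * (mode ω j * k)))).aestronglyMeasurable
    · refine Eventually.of_forall fun t _ => ?_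
      change ‖fc j h * ((mode ω (-m) : ℝ → ℂ) t * ((mode ω j : ℝ → ℂ) t * (k : ℝ → ℂ) t))‖ ≤ _
      rw [norm_mul, norm_mul, norm_mul, norm_mode_apply, norm_mode_apply, one_mul, one_mul]
      exact mul_le_mul_of_nonneg_left (hB t) (norm_nonneg _)
    · exact Eventually.of_forall fun t _ => hs.mul_right B
    · simp
    · refine Eventually.of_forall fun t _ => ?_
      have h1 := ((hasSum_fc h hs t).mul_right ((k : ℝ → ℂ) t)).mul_left ((mode ω (-m) : ℝ → ℂ) t)
      change HasSum (fun j => fc j h * ((mode ω (-m) : ℝ → ℂ) t *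
        ((mode ω j : ℝ → ℂ) t * (k : ℝ → ℂ) t))) _
      have h2 : ∀ j, fc j h * ((mode ω (-m) : ℝ → ℂ) t *
          ((mode ω j : ℝ → ℂ) t * (k : ℝ → ℂ) t)) = (mode ω (-m) : ℝ → ℂ) t *
          (fc j h * (mode ω j : ℝ → ℂ) t * (k : ℝ → ℂ) t) := fun j => by ring
      simp only [h2]
      exact h1
  have h1 := key.mul_left ((ω / (2 * Real.pi) : ℝ) : ℂ)
  have h2 : ∀ j, fc j h * fc (m - j) k = (ω / (2 * Real.pi) : ℝ) *
      ∫ t in (0 : ℝ)..(2 * Real.pi / ω),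
        (fc j h • (mode ω (-m) * (mode ω j * k)) : ℝ → ℂ) t := fun j => by
    rw [← fc_mode_mul, ← fc_smul, fc, avg_apply, mul_smul_comm]
    rfl
  simp only [h2]
  exact h1

end Fourier

/-- From `c² ≤ 2 (a² + b²)`. It serves twice: for the Fourier weights and for the factors `1/n²` of
the majorant. -/
theorem inv_sq_mul_inv_sq_le {a b c : ℝ} (ha : 0 < a) (hb : 0 < b) (hc : 0 < c) (h : c ≤ a + b) :
    (a ^ 2)⁻¹ * (b ^ 2)⁻¹ ≤ 2 * (c ^ 2)⁻¹ * ((a ^ 2)⁻¹ + (b ^ 2)⁻¹) := by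
  have h1 : c ^ 2 ≤ 2 * (a ^ 2 + b ^ 2) := by nlinarith [sq_nonneg (a - b)]
  have h2 : 2 * (c ^ 2)⁻¹ * ((a ^ 2)⁻¹ + (b ^ 2)⁻¹) =
      (a ^ 2)⁻¹ * (b ^ 2)⁻¹ * (2 * (a ^ 2 + b ^ 2) / c ^ 2) := by
    field_simp
    ring
  rw [h2]
  exact le_mul_of_one_le_right (by positivity) ((one_le_div (by positivity)).2 h1)

/-! ### Weights stable under convolution. -/

section Weight

theorem bra_pos (m : ℤ) : 0 < bra m := by
  unfold bra
  split_ifs with h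
  · norm_num
  · exact abs_pos.2 (by exact_mod_cast h)

theorem one_le_bra (m : ℤ) : 1 ≤ bra m := by
  unfold bra
  split_ifs with h
  · exact le_rfl
  · exact_mod_cast Int.one_le_abs h

theorem abs_le_bra (m : ℤ) : |(m : ℝ)| ≤ bra m := by
  unfold bra
  split_ifs with h
  · simp [h]
  · exact le_rfl

theorem bra_neg (m : ℤ) : bra (-m) = bra m := by simp [bra]

theorem bra_le_add (j m : ℤ) : bra m ≤ bra j + bra (m - j) := by
  by_cases hm : m = 0
  · have h1 := one_le_bra j
    have h2 := one_le_bra (m - j)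
    have h3 : bra m = 1 := by simp [bra, hm]
    linarith
  · have h1 : bra m = |(m : ℝ)| := by simp [bra, hm]
    have h2 := abs_le_bra j
    have h3 := abs_le_bra (m - j)
    have h4 := abs_add_le (j : ℝ) ((m - j : ℤ) : ℝ)
    push_cast at h3 h4
    rw [add_sub_cancel] at h4
    rw [h1]
    linarith

/-- The weight `e^{-χ|m|} / ⟨m⟩²`. -/
def weight (χ : ℝ) (m : ℤ) : ℝ := Real.exp (-χ * |(m : ℝ)|) / bra m ^ 2

theorem weight_pos (χ : ℝ) (m : ℤ) : 0 < weight χ m :=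
  div_pos (Real.exp_pos _) (pow_pos (bra_pos m) 2)

theorem weight_zero (χ : ℝ) : weight χ 0 = 1 := by simp [weight, bra]

theorem weight_neg (χ : ℝ) (m : ℤ) : weight χ (-m) = weight χ m := by
  simp [weight, bra_neg]

theorem summable_inv_bra_sq : Summable fun m : ℤ => (bra m ^ 2)⁻¹ := by
  have h1 : Summable fun m : ℤ => 1 / (m : ℝ) ^ 2 := Real.summable_one_div_int_pow.2 (by norm_num)
  have h2 : Summable fun m : ℤ => if m = 0 then (1 : ℝ) else 0 :=
    summable_of_ne_finset_zero (s := {0}) fun m hm => by simp at hm; simp [hm]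
  refine (h1.add h2).congr fun m => ?_
  by_cases hm : m = 0
  · simp [bra, hm]
  · simp [bra, hm]

theorem weight_le {χ : ℝ} (hχ : 0 < χ) (m : ℤ) : weight χ m ≤ (bra m ^ 2)⁻¹ := by
  rw [weight, div_eq_mul_inv]
  refine mul_le_of_le_one_left (by positivity) (Real.exp_le_one_iff.2 ?_)
  have := mul_nonneg hχ.le (abs_nonneg (m : ℝ))
  linarith

theorem summable_weight {χ : ℝ} (hχ : 0 < χ) : Summable (weight χ) :=
  Summable.of_nonneg_of_le (fun m => (weight_pos χ m).le) (weight_le hχ) summable_inv_bra_sq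

theorem weight_mul_weight_le {χ : ℝ} (hχ : 0 < χ) (j m : ℤ) :
    weight χ j * weight χ (m - j) ≤ 2 * weight χ m * ((bra j ^ 2)⁻¹ + (bra (m - j) ^ 2)⁻¹) := by
  have h1 := inv_sq_mul_inv_sq_le (bra_pos j) (bra_pos (m - j)) (bra_pos m) (bra_le_add j m)
  have h2 : Real.exp (-χ * |(j : ℝ)|) * Real.exp (-χ * |((m - j : ℤ) : ℝ)|) ≤
      Real.exp (-χ * |(m : ℝ)|) := by
    rw [← Real.exp_add]
    refine Real.exp_le_exp.2 ?_
    have h4 := abs_add_le (j : ℝ) ((m - j : ℤ) : ℝ)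
    push_cast at h4 ⊢
    rw [add_sub_cancel] at h4
    nlinarith
  simp only [weight, div_eq_mul_inv]
  calc _ = (Real.exp (-χ * |(j : ℝ)|) * Real.exp (-χ * |((m - j : ℤ) : ℝ)|)) *
        ((bra j ^ 2)⁻¹ * (bra (m - j) ^ 2)⁻¹) := by ring
    _ ≤ Real.exp (-χ * |(m : ℝ)|) *
        (2 * (bra m ^ 2)⁻¹ * ((bra j ^ 2)⁻¹ + (bra (m - j) ^ 2)⁻¹)) := by
      gcongr
    _ = _ := by ring

/-- The weights are stable under convolution. -/
theorem exists_weight_conv {χ : ℝ} (hχ : 0 < χ) : ∃ C : ℝ, 0 < C ∧ ∀ m : ℤ,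
    (Summable fun j => weight χ j * weight χ (m - j)) ∧
      ∑' j, weight χ j * weight χ (m - j) ≤ C * weight χ m := by
  have hs := summable_inv_bra_sq
  have hpos : 0 < ∑' m : ℤ, (bra m ^ 2)⁻¹ :=
    hs.tsum_pos (fun m => by positivity) 0 (by simp [bra])
  -- A factor `2` from the pointwise estimate, and another because its two summands have equal sums
  -- over `j`.
  refine ⟨4 * ∑' m : ℤ, (bra m ^ 2)⁻¹, by positivity, fun m => ?_⟩
  have hs' : Summable fun j : ℤ => (bra (m - j) ^ 2)⁻¹ :=
    (Equiv.subLeft m).summable_iff.2 hs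
  have he : ∑' j : ℤ, (bra (m - j) ^ 2)⁻¹ = ∑' j : ℤ, (bra j ^ 2)⁻¹ :=
    (Equiv.subLeft m).tsum_eq fun j => (bra j ^ 2)⁻¹
  have hb := (hs.add hs').mul_left (2 * weight χ m)
  have hw : Summable fun j => weight χ j * weight χ (m - j) :=
    Summable.of_nonneg_of_le (fun j => (mul_pos (weight_pos _ _) (weight_pos _ _)).le)
      (fun j => weight_mul_weight_le hχ j m) hb
  refine ⟨hw, (hw.tsum_le_tsum (fun j => weight_mul_weight_le hχ j m) hb).trans_eq ?_⟩
  rw [tsum_mul_left, hs.tsum_add hs', he]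
  ring

end Weight

/-! ### Boundedness of products and primitives in the weighted Fourier bound. -/

section FourierBound

variable {ω : ℝ} [hω : Fact (0 < ω)] {χ : ℝ}

/-- The Fourier coefficients of `h` are bounded by `B e^{-χ|m|} / ⟨m⟩²`. -/
def FBound (χ B : ℝ) (h : PerAlg ω) : Prop := ∀ m, ‖fc m h‖ ≤ B * weight χ m

variable {a b : ℝ} {h k : PerAlg ω}

theorem FBound.norm_avg_le (H : FBound χ a h) : ‖avg ω h‖ ≤ a := by
  simpa [fc_zero, weight_zero] using H 0

theorem FBound.nonneg (H : FBound χ a h) : 0 ≤ a := (norm_nonneg _).trans H.norm_avg_le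

theorem FBound.mono (H : FBound χ a h) (hab : a ≤ b) : FBound χ b h := fun m =>
  (H m).trans (mul_le_mul_of_nonneg_right hab (weight_pos χ m).le)

theorem FBound.add (H : FBound χ a h) (K : FBound χ b k) : FBound χ (a + b) (h + k) := fun m => by
  rw [fc_add, add_mul]
  exact norm_add_le_of_le (H m) (K m)

theorem FBound.smul (c : ℂ) (H : FBound χ a h) : FBound χ (‖c‖ * a) (c • h) := fun m => by
  rw [fc_smul, norm_mul, mul_assoc]
  exact mul_le_mul_of_nonneg_left (H m) (norm_nonneg _)

theorem FBound.cconj (H : FBound χ a h) : FBound χ a (cconj h) := fun m => by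
  rw [fc_cconj, RCLike.norm_conj, ← weight_neg]
  exact H (-m)

theorem FBound.zero : FBound χ 0 (0 : PerAlg ω) := fun m => by
  simp [fc]

theorem FBound.sum {ι : Type*} (s : Finset ι) (B : ι → ℝ) (g : ι → PerAlg ω)
    (H : ∀ i ∈ s, FBound χ (B i) (g i)) : FBound χ (∑ i ∈ s, B i) (∑ i ∈ s, g i) := by
  induction s using Finset.cons_induction with
  | empty => simpa using FBound.zero
  | cons i s hi ih =>
    rw [Finset.sum_cons, Finset.sum_cons]
    exact (H i (Finset.mem_cons_self i s)).add
      (ih fun j hj => H j (Finset.mem_cons_of_mem hj))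

theorem FBound.one : FBound χ 1 (1 : PerAlg ω) := fun m => by
  by_cases hm : m = 0
  · subst hm
    rw [fc_zero, avg_one, weight_zero]
    simp
  · rw [fc, mul_one, (avg_mode_and_prim_mode (neg_ne_zero.2 hm)).1, norm_zero, one_mul]
    exact (weight_pos χ m).le

theorem FBound.summable (hχ : 0 < χ) (H : FBound χ a h) : Summable fun m => ‖fc m h‖ :=
  Summable.of_nonneg_of_le (fun _ => norm_nonneg _) H ((summable_weight hχ).mul_left a)

theorem FBound.norm_apply_le (hχ : 0 < χ) (H : FBound χ a h) (t : ℝ) :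
    ‖(h : ℝ → ℂ) t‖ ≤ a * ∑' m, weight χ m := by
  rw [← (hasSum_fc h (H.summable hχ) t).tsum_eq, ← tsum_mul_left]
  refine tsum_of_norm_bounded ((summable_weight hχ).mul_left a).hasSum fun m => ?_
  rw [norm_mul, norm_mode_apply, mul_one]
  exact H m

/-- Functions with exponentially decaying Fourier coefficients form an algebra. -/
theorem exists_fBound_mul (ω : ℝ) [Fact (0 < ω)] (hχ : 0 < χ) :
    ∃ C : ℝ, 0 < C ∧ ∀ (a b : ℝ) (h k : PerAlg ω), FBound χ a h → FBound χ b k →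
      FBound χ (C * a * b) (h * k) := by
  obtain ⟨C, hC, hw⟩ := exists_weight_conv hχ
  refine ⟨C, hC, fun a b h k H K m => ?_⟩
  obtain ⟨hs, hle⟩ := hw m
  rw [← (hasSum_fc_mul h k (H.summable hχ) m).tsum_eq]
  have h1 : ‖∑' j, fc j h * fc (m - j) k‖ ≤ a * b * ∑' j, weight χ j * weight χ (m - j) := by
    rw [← tsum_mul_left]
    refine tsum_of_norm_bounded (hs.mul_left (a * b)).hasSum fun j => ?_
    rw [norm_mul]
    calc ‖fc j h‖ * ‖fc (m - j) k‖ ≤ (a * weight χ j) * (b * weight χ (m - j)) :=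
          mul_le_mul (H j) (K _) (norm_nonneg _) ((norm_nonneg _).trans (H j))
      _ = _ := by ring
  refine h1.trans ((mul_le_mul_of_nonneg_left hle (mul_nonneg H.nonneg K.nonneg)).trans_eq ?_)
  ring

theorem norm_fc_prim_le {m : ℤ} (hm : m ≠ 0) (H : FBound χ a h) :
    ‖fc m (prim ω h)‖ ≤ a / ω * weight χ m := by
  have h1 : (1 : ℝ) ≤ ‖(m : ℂ)‖ := by
    rw [Complex.norm_intCast]
    exact_mod_cast Int.one_le_abs hm
  have hω' := hω.out
  rw [fc_prim hm, norm_div, norm_mul, norm_mul, Complex.norm_I, one_mul, Complex.norm_real,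
    Real.norm_of_nonneg hω'.le, div_le_iff₀ (by positivity)]
  calc ‖fc m h‖ ≤ a * weight χ m := H m
    _ = a / ω * weight χ m * (1 * ω) := by field_simp
    _ ≤ _ := by
      have := H.nonneg
      have := (weight_pos χ m).le
      gcongr

/-- Away from `m = 0` the factor `imω` only helps. The zeroth coefficient is not seen by `fc_prim`;
since the primitive vanishes at `t = 0`, it is minus the sum of all the others. -/
theorem exists_fBound_prim (ω : ℝ) [hω : Fact (0 < ω)] (hχ : 0 < χ) :
    ∃ C : ℝ, 0 < C ∧ ∀ (a : ℝ) (h : PerAlg ω), FBound χ a h → FBound χ (C * a) (prim ω h) := by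
  have hω' := hω.out
  have hW : 0 ≤ ∑' m, weight χ m := tsum_nonneg fun m => (weight_pos χ m).le
  refine ⟨(1 + ∑' m, weight χ m) / ω, by positivity, fun a h H m => ?_⟩
  have ha := H.nonneg
  by_cases hm : m = 0
  · subst hm
    -- A crude bound containing the unknown zeroth coefficient, used only to make the Fourier series
    -- summable.
    have h1 : FBound χ (a / ω + ‖fc 0 (prim ω h)‖) (prim ω h) := fun m => by
      by_cases hm : m = 0
      · subst hm
        rw [weight_zero, mul_one]
        exact le_add_of_nonneg_left (by positivity)
      · refine (norm_fc_prim_le hm H).trans ?_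
        exact mul_le_mul_of_nonneg_right (le_add_of_nonneg_right (norm_nonneg _))
          (weight_pos χ m).le
    have h2 := hasSum_fc (prim ω h) (h1.summable hχ) 0
    rw [prim_zero_apply] at h2
    have h3 := h2.update 0 0
    simp only [mode_apply, Complex.ofReal_zero, mul_zero, Complex.exp_zero, mul_one, add_zero,
      zero_sub] at h3
    have h4 : ‖-fc 0 (prim ω h)‖ ≤ a / ω * ∑' m, weight χ m := by
      rw [← h3.tsum_eq, ← tsum_mul_left]
      refine tsum_of_norm_bounded ((summable_weight hχ).mul_left (a / ω)).hasSum fun m => ?_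
      by_cases hm : m = 0
      · subst hm
        have := (weight_pos χ 0).le
        simp only [Function.update_self, norm_zero]
        positivity
      · rw [Function.update_of_ne hm]
        exact norm_fc_prim_le hm H
    rw [norm_neg] at h4
    rw [weight_zero, mul_one]
    refine h4.trans ?_
    calc a / ω * ∑' m, weight χ m ≤ a / ω * (1 + ∑' m, weight χ m) := by gcongr; linarith
      _ = _ := by ring
  · refine (norm_fc_prim_le hm H).trans (mul_le_mul_of_nonneg_right ?_ (weight_pos χ m).le)
    calc a / ω = a / ω * 1 := by ring
      _ ≤ a / ω * (1 + ∑' m, weight χ m) := by gcongr; linarith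
      _ = _ := by ring

/-- Some bound on the Fourier coefficients. -/
def FDecay (χ : ℝ) (h : PerAlg ω) : Prop := ∃ B, FBound χ B h

theorem FDecay.add (H : FDecay χ h) (K : FDecay χ k) : FDecay χ (h + k) :=
  let ⟨_, H⟩ := H; let ⟨_, K⟩ := K; ⟨_, H.add K⟩

theorem FDecay.smul (c : ℂ) (H : FDecay χ h) : FDecay χ (c • h) :=
  let ⟨_, H⟩ := H; ⟨_, H.smul c⟩

theorem FDecay.mul (hχ : 0 < χ) (H : FDecay χ h) (K : FDecay χ k) : FDecay χ (h * k) :=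
  let ⟨_, _, hC⟩ := exists_fBound_mul ω hχ
  let ⟨_, H⟩ := H; let ⟨_, K⟩ := K; ⟨_, hC _ _ _ _ H K⟩

theorem FDecay.prim (hχ : 0 < χ) (H : FDecay χ h) : FDecay χ (prim ω h) :=
  let ⟨_, _, hC⟩ := exists_fBound_prim ω hχ
  let ⟨_, H⟩ := H; ⟨_, hC _ _ H⟩

/-- Operators which are bounded with respect to the weighted bound on Fourier coefficients. -/
def FBounded (χ : ℝ) (Φ : PerAlg ω → PerAlg ω) : Prop :=
  ∃ K : ℝ, 0 ≤ K ∧ ∀ (B : ℝ) (h : PerAlg ω), FBound χ B h → FBound χ (K * B) (Φ h)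

theorem FDecay.fBounded_mul_prim (hχ : 0 < χ) (H : FDecay χ h) {Φ : PerAlg ω → PerAlg ω}
    (hΦ : FBounded χ Φ) : FBounded χ fun g => h * Secular.prim ω (Φ g) := by
  obtain ⟨C, hC, hmul⟩ := exists_fBound_mul ω hχ
  obtain ⟨D, hD, hprim⟩ := exists_fBound_prim ω hχ
  obtain ⟨a, H⟩ := H
  obtain ⟨K, hK, hΦ⟩ := hΦ
  have ha := H.nonneg
  refine ⟨C * a * (D * K), by positivity, fun B g G => ?_⟩
  have := hmul _ _ _ _ H (hprim _ _ (hΦ B g G))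
  exact this.mono (by ring_nf; rfl)

theorem FDecay.fBounded_mul (hχ : 0 < χ) (H : FDecay χ h) {Φ : PerAlg ω → PerAlg ω}
    (hΦ : FBounded χ Φ) : FBounded χ fun g => h * Φ g := by
  obtain ⟨C, hC, hmul⟩ := exists_fBound_mul ω hχ
  obtain ⟨a, H⟩ := H
  obtain ⟨K, hK, hΦ⟩ := hΦ
  have ha := H.nonneg
  refine ⟨C * a * K, by positivity, fun B g G => ?_⟩
  exact (hmul _ _ _ _ H (hΦ B g G)).mono (by ring_nf; rfl)

theorem fBounded_id : FBounded χ (fun g : PerAlg ω => g) :=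
  ⟨1, zero_le_one, fun B g G => by rwa [one_mul]⟩

end FourierBound

/-! ### A majorant for the shifted quadratic recursion. -/

/-- The sum `∑ b_p b_r` over `p + r = n + j` with `j < p, r < n`. -/
def shiftConv (b : ℕ → ℝ) (j n : ℕ) : ℝ := ∑ p ∈ Finset.Icc (j + 1) (n - 1), b p * b (n + j - p)

section Majorant

theorem sum_inv_sq_le (s : Finset ℕ) :
    ∑ p ∈ s, ((p : ℝ) ^ 2)⁻¹ ≤ ∑' p : ℕ, ((p : ℝ) ^ 2)⁻¹ :=
  Summable.sum_le_tsum s (fun _ _ => by positivity) (Real.summable_nat_pow_inv.2 (by norm_num))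

theorem sum_Icc_reflect_shift (F : ℕ → ℝ) (j n : ℕ) :
    ∑ p ∈ Finset.Icc (j + 1) (n - 1), F (n + j - p) = ∑ p ∈ Finset.Icc (j + 1) (n - 1), F p := by
  refine Finset.sum_nbij' (fun p => n + j - p) (fun p => n + j - p) ?_ ?_ ?_ ?_ ?_ <;>
    intro p hp <;> rw [Finset.mem_Icc] at hp <;> first
      | (rw [Finset.mem_Icc]; omega)
      | omega

theorem sum_inv_sq_mul_inv_sq_le (j n : ℕ) (hn : 4 ≤ n) :
    ∑ p ∈ Finset.Icc (j + 1) (n - 1), ((p : ℝ) ^ 2)⁻¹ * (((n + j - p : ℕ) : ℝ) ^ 2)⁻¹ ≤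
      4 * (∑' p : ℕ, ((p : ℝ) ^ 2)⁻¹) * ((n : ℝ) ^ 2)⁻¹ := by
  have h1 : ∀ p ∈ Finset.Icc (j + 1) (n - 1),
      ((p : ℝ) ^ 2)⁻¹ * (((n + j - p : ℕ) : ℝ) ^ 2)⁻¹ ≤
        2 * ((n : ℝ) ^ 2)⁻¹ * (((p : ℝ) ^ 2)⁻¹ + (((n + j - p : ℕ) : ℝ) ^ 2)⁻¹) := by
    intro p hp
    rw [Finset.mem_Icc] at hp
    refine inv_sq_mul_inv_sq_le ?_ ?_ ?_ ?_
    · exact_mod_cast (by omega : 0 < p)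
    · exact_mod_cast (by omega : 0 < n + j - p)
    · exact_mod_cast (by omega : 0 < n)
    · exact_mod_cast (by omega : n ≤ p + (n + j - p))
  refine (Finset.sum_le_sum h1).trans ?_
  rw [← Finset.mul_sum, Finset.sum_add_distrib,
    sum_Icc_reflect_shift (fun p => ((p : ℝ) ^ 2)⁻¹)]
  have h2 := sum_inv_sq_le (Finset.Icc (j + 1) (n - 1))
  have h3 : (0 : ℝ) ≤ ((n : ℝ) ^ 2)⁻¹ := by positivity
  nlinarith

variable {δ β M : ℝ}

/-- If both indices are at least 4, the exponents add up to `n + j - 6 ≤ n - 3`, with equality at `j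
= 3`, so smallness must come from `δ²`. Otherwise a low-index factor carries no power of `M`, the
other exponent is at most `n - 4`, and a factor `1/M` is gained. -/
theorem majorant_mul_le (hδ : 0 < δ) (hδβ : δ ≤ β) (hM : 1 ≤ M) {n j p r : ℕ} (hn : 4 ≤ n)
    (hj : j ≤ 3) (hp : j + 1 ≤ p) (hr : j + 1 ≤ r) (hpr : p + r = n + j) :
    (if p ≤ 3 then β else δ) * M ^ (p - 3) * ((if r ≤ 3 then β else δ) * M ^ (r - 3)) ≤
      (δ ^ 2 + β ^ 2 / M) * M ^ (n - 3) := by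
  have hM0 : 0 < M := by linarith
  have hβ : 0 < β := by linarith
  have hpow : ∀ k, 0 < M ^ k := fun k => pow_pos hM0 k
  by_cases h : 4 ≤ p ∧ 4 ≤ r
  · rw [if_neg (by omega), if_neg (by omega)]
    calc δ * M ^ (p - 3) * (δ * M ^ (r - 3)) = δ ^ 2 * M ^ (p - 3 + (r - 3)) := by
          rw [pow_add]; ring
      _ ≤ δ ^ 2 * M ^ (n - 3) := by
          gcongr
          omega
      _ ≤ _ := by
          have := hpow (n - 3)
          have : 0 ≤ β ^ 2 / M := by positivity
          gcongr
          linarith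
  · have h1 : (if p ≤ 3 then β else δ) ≤ β := by split_ifs <;> linarith
    have h2 : (if r ≤ 3 then β else δ) ≤ β := by split_ifs <;> linarith
    have h3 : 0 ≤ (if r ≤ 3 then β else δ) := by split_ifs <;> linarith
    calc (if p ≤ 3 then β else δ) * M ^ (p - 3) * ((if r ≤ 3 then β else δ) * M ^ (r - 3))
        ≤ β * M ^ (p - 3) * (β * M ^ (r - 3)) := by
          have := hpow (p - 3)
          have := hpow (r - 3)
          gcongr
      _ = β ^ 2 * M ^ (p - 3 + (r - 3)) := by rw [pow_add]; ring
      _ ≤ β ^ 2 * M ^ (n - 4) := by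
          gcongr
          omega
      _ = β ^ 2 / M * M ^ (n - 3) := by
          rw [show n - 3 = n - 4 + 1 by omega, pow_succ M, div_mul_eq_mul_div, ← mul_assoc,
            mul_div_cancel_right₀ _ hM0.ne']
      _ ≤ _ := by
          have := hpow (n - 3)
          gcongr
          nlinarith

/-- The shift `j = 3` defeats a plain geometric ansatz, so indices above 3 get their own small
constant `δ`, while the prescribed initial values are carried by a large `β`. -/
theorem exists_majorant {K B : ℝ} (hK : 0 ≤ K) (hB : 0 ≤ B) : ∃ b : ℕ → ℝ,
    (∀ n, 1 ≤ n → n ≤ 3 → B ≤ b n) ∧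
    (∀ n, 4 ≤ n → K * (shiftConv b 0 n + shiftConv b 1 n + shiftConv b 2 n + shiftConv b 3 n) ≤
      b n) ∧
    ∃ M₀ M₁ : ℝ, 0 < M₀ ∧ 0 < M₁ ∧ ∀ n, 1 ≤ n → b n ≤ M₀ * M₁ ^ n := by
  obtain ⟨Z, hZ⟩ : ∃ Z, Z = ∑' p : ℕ, ((p : ℝ) ^ 2)⁻¹ := ⟨_, rfl⟩
  have hZ0 : 0 ≤ Z := hZ ▸ tsum_nonneg fun p => by positivity
  have hL0 : 0 ≤ K * Z := mul_nonneg hK hZ0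
  -- Four shifts and the constant 4 of `sum_inv_sq_mul_inv_sq_le` give 16; the bound 32 lets the
  -- `δ²` part use half of `δ`, and the choice of `M` below gives the `β²/M` part the other half.
  obtain ⟨δ, hδ, hδ1, hδL⟩ : ∃ δ : ℝ, 0 < δ ∧ δ ≤ 1 ∧ 32 * (K * Z) * δ ≤ 1 := by
    refine ⟨1 / (32 * (K * Z) + 1), by positivity, ?_, ?_⟩
    · rw [div_le_one (by positivity)]; linarith
    · rw [mul_one_div, div_le_one (by positivity)]; linarith
  -- The 9 compensates the factor `1/n²` for `n ≤ 3`.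
  obtain ⟨β, hβB, hβ1⟩ : ∃ β : ℝ, 9 * B ≤ β ∧ 1 ≤ β := ⟨9 * B + 1, by linarith, by linarith⟩
  obtain ⟨M, hM1, hML⟩ : ∃ M : ℝ, 1 ≤ M ∧ 32 * (K * Z) * (β ^ 2 / M) ≤ δ := by
    have h0 : 0 ≤ 32 * (K * Z) * β ^ 2 / δ := by positivity
    refine ⟨1 + 32 * (K * Z) * β ^ 2 / δ, by linarith, ?_⟩
    rw [← mul_div_assoc, div_le_iff₀ (by linarith)]
    have : δ * (32 * (K * Z) * β ^ 2 / δ) = 32 * (K * Z) * β ^ 2 := by field_simp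
    rw [mul_add, this]
    linarith
  have hM0 : 0 < M := by linarith
  have hδβ : δ ≤ β := by linarith
  refine ⟨fun n => (if n ≤ 3 then β else δ) * M ^ (n - 3) * ((n : ℝ) ^ 2)⁻¹, fun n h1 h3 => ?_,
    fun n hn => ?_, β, M, by linarith, hM0, fun n hn => ?_⟩
  · simp only [if_pos h3, Nat.sub_eq_zero_of_le h3, pow_zero, mul_one]
    rw [← div_eq_mul_inv, le_div_iff₀ (by positivity)]
    have h4 : (n : ℝ) ≤ 3 := by exact_mod_cast h3
    have h5 : (n : ℝ) ^ 2 ≤ 9 := by nlinarith [(Nat.cast_nonneg n : (0 : ℝ) ≤ n)]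
    nlinarith
  · have hT : ∀ j, j ≤ 3 → shiftConv (fun n => (if n ≤ 3 then β else δ) * M ^ (n - 3) *
        ((n : ℝ) ^ 2)⁻¹) j n ≤
        (δ ^ 2 + β ^ 2 / M) * M ^ (n - 3) * (4 * Z * ((n : ℝ) ^ 2)⁻¹) := by
      intro j hj
      rw [hZ]
      refine le_trans ?_ (mul_le_mul_of_nonneg_left (sum_inv_sq_mul_inv_sq_le j n hn)
        (by positivity))
      rw [shiftConv, Finset.mul_sum]
      refine Finset.sum_le_sum fun p hp => ?_
      rw [Finset.mem_Icc] at hp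
      have := majorant_mul_le hδ hδβ hM1 hn hj hp.1 (by omega : j + 1 ≤ n + j - p) (by omega)
      refine le_trans (le_of_eq ?_) (mul_le_mul_of_nonneg_right this (by positivity))
      ring
    have h0 := hT 0 (by norm_num)
    have h1 := hT 1 (by norm_num)
    have h2 := hT 2 (by norm_num)
    have h3 := hT 3 (by norm_num)
    simp only [if_neg (by omega : ¬ n ≤ 3)]
    calc _ ≤ K * (4 * ((δ ^ 2 + β ^ 2 / M) * M ^ (n - 3) * (4 * Z * ((n : ℝ) ^ 2)⁻¹))) := by
          refine mul_le_mul_of_nonneg_left ?_ hK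
          linarith
      _ = (16 * (K * Z) * δ * δ + 16 * (K * Z) * (β ^ 2 / M)) *
            (M ^ (n - 3) * ((n : ℝ) ^ 2)⁻¹) := by ring
      _ ≤ δ * (M ^ (n - 3) * ((n : ℝ) ^ 2)⁻¹) := by
          refine mul_le_mul_of_nonneg_right ?_ (by positivity)
          nlinarith
      _ = _ := by ring
  · have h1 : (if n ≤ 3 then β else δ) ≤ β := by split_ifs <;> linarith
    have h2 : ((n : ℝ) ^ 2)⁻¹ ≤ 1 := by
      have : (1 : ℝ) ≤ n := by exact_mod_cast hn
      exact inv_le_one_of_one_le₀ (by nlinarith)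
    have h3 : M ^ (n - 3) ≤ M ^ n := pow_le_pow_right₀ hM1 (by omega)
    have h4 : 0 < M ^ (n - 3) := by positivity
    calc (if n ≤ 3 then β else δ) * M ^ (n - 3) * ((n : ℝ) ^ 2)⁻¹ ≤ β * M ^ n * 1 := by gcongr
      _ = _ := mul_one _

end Majorant

/-! ### Geometric bounds for the expansion coefficients. -/

section Bounds

variable {ω : ℝ} [hω : Fact (0 < ω)] {χ : ℝ}

theorem FBounded.add {Φ Ψ : PerAlg ω → PerAlg ω} (hΦ : FBounded χ Φ) (hΨ : FBounded χ Ψ) :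
    FBounded χ fun g => Φ g + Ψ g := by
  obtain ⟨K, hK, hΦ⟩ := hΦ
  obtain ⟨L, hL, hΨ⟩ := hΨ
  refine ⟨K + L, by positivity, fun B g G => ?_⟩
  rw [add_mul]
  exact (hΦ B g G).add (hΨ B g G)

theorem FBounded.smul {Φ : PerAlg ω → PerAlg ω} (c : ℂ) (hΦ : FBounded χ Φ) :
    FBounded χ fun g => c • Φ g := by
  obtain ⟨K, hK, hΦ⟩ := hΦ
  refine ⟨‖c‖ * K, by positivity, fun B g G => ?_⟩
  rw [mul_assoc]
  exact (hΦ B g G).smul c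

theorem fBound_conv (ω : ℝ) [Fact (0 < ω)] (hχ : 0 < χ) : ∃ C : ℝ, 0 ≤ C ∧
    ∀ (v : ℕ → PerAlg ω) (b : ℕ → ℝ) (n : ℕ),
    (∀ p, 1 ≤ p → p < n → FBound χ (b p) (v p)) → FBound χ (C * shiftConv b 0 n) (conv v n) := by
  obtain ⟨C, hC, hmul⟩ := exists_fBound_mul ω hχ
  refine ⟨C, hC.le, fun v b n hb => ?_⟩
  rw [conv, shiftConv, Finset.mul_sum]
  refine FBound.sum _ _ _ fun p hp => ?_
  rw [Finset.mem_Icc] at hp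
  rw [add_zero, ← mul_assoc]
  exact hmul _ _ _ _ (hb p (by omega) (by omega)) (hb (n - p) (by omega) (by omega))

/-- The mean is the zeroth Fourier coefficient. The constant depends on the operator alone, which
keeps the later recursion uniform in `n`. -/
theorem FBounded.norm_sum_avg_le (hχ : 0 < χ) {Φ : PerAlg ω → PerAlg ω} (hΦ : FBounded χ Φ) :
    ∃ K : ℝ, 0 ≤ K ∧ ∀ (v : ℕ → PerAlg ω) (b : ℕ → ℝ) (j n : ℕ),
      (∀ p, 1 ≤ p → p < n → FBound χ (b p) (v p)) →
      ‖∑ p ∈ Finset.Icc (j + 1) (n - 1), avg ω (Φ (v p * v (n + j - p)))‖ ≤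
        K * shiftConv b j n := by
  obtain ⟨C, hC, hmul⟩ := exists_fBound_mul ω hχ
  obtain ⟨K, hK, hΦ⟩ := hΦ
  refine ⟨K * C, by positivity, fun v b j n hb => ?_⟩
  rw [shiftConv, Finset.mul_sum]
  refine norm_sum_le_of_le _ fun p hp => ?_
  rw [Finset.mem_Icc] at hp
  have := hΦ _ _ (hmul _ _ _ _ (hb p (by omega) (by omega))
    (hb (n + j - p) (by omega) (by omega)))
  exact this.norm_avg_le.trans (by ring_nf; rfl)

theorem shiftConv_nonneg {v : ℕ → PerAlg ω} {b : ℕ → ℝ} {n : ℕ}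
    (hb : ∀ p, 1 ≤ p → p < n → FBound χ (b p) (v p)) (j : ℕ) : 0 ≤ shiftConv b j n := by
  refine Finset.sum_nonneg fun p hp => ?_
  rw [Finset.mem_Icc] at hp
  exact mul_nonneg (hb p (by omega) (by omega)).nonneg
    (hb (n + j - p) (by omega) (by omega)).nonneg

/-- At order `n + 3` the sums starting at `p = 1, 2, 3` have total index `n`, `n + 1`, `n + 2`:
these are the shifts 0, 1, 2. -/
theorem exists_norm_algR1_le (hχ : 0 < χ) {x y : PerAlg ω} (hx : FDecay χ x) (hy : FDecay χ y)
    (κ : ℕ → ℂ) (v : ℕ → PerAlg ω) : ∃ K : ℝ, 0 ≤ K ∧ ∀ (b : ℕ → ℝ) (n : ℕ),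
      (∀ p, 1 ≤ p → p < n → FBound χ (b p) (v p)) →
      ‖algR1 (prim ω) x y κ v (avg ω) (n + 3)‖ ≤
        K * (shiftConv b 0 n + shiftConv b 1 n + shiftConv b 2 n) := by
  have hxg := hx.fBounded_mul_prim hχ fBounded_id
  have hxx := hx.fBounded_mul_prim hχ hxg
  have hxxx := hx.fBounded_mul_prim hχ hxx
  have hxy := hx.fBounded_mul_prim hχ ((hx.mul hχ (hy.prim hχ)).fBounded_mul_prim hχ fBounded_id)
  have hxX := hx.fBounded_mul_prim hχ ((hx.mul hχ (hx.prim hχ)).fBounded_mul_prim hχ fBounded_id)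
  obtain ⟨K0, hK0, h0⟩ := ((((hxxx.smul (-2 * κ 1 ^ 2)).add hxy).add
    (hxX.smul (-κ 1 ^ 2))).add (hxx.smul (Complex.I * κ 2))).norm_sum_avg_le hχ
  obtain ⟨K1, hK1, h1⟩ := hxx.norm_sum_avg_le hχ
  obtain ⟨K2, hK2, h2⟩ := hxg.norm_sum_avg_le hχ
  refine ⟨‖2 * Complex.I * κ 1‖ * K0 + ‖2 * κ 1 ^ 2‖ * K1 + ‖Complex.I * κ 1‖ * K2, by positivity,
    fun b n hb => ?_⟩
  have e0 := h0 v b 0 n hb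
  have e1 := h1 v b 1 n hb
  have e2 := h2 v b 2 n hb
  have s0 := shiftConv_nonneg hb 0
  have s1 := shiftConv_nonneg hb 1
  have s2 := shiftConv_nonneg hb 2
  simp only [map_add, map_smul, smul_eq_mul, neg_mul, ← sub_eq_add_neg, zero_add, add_zero,
    Nat.reduceAdd] at e0 e1 e2
  simp only [algR1, show n + 3 - 4 = n - 1 by omega, show n + 3 - 3 = n by omega,
    show n + 3 - 2 = n + 1 by omega, show n + 3 - 1 = n + 2 by omega, neg_mul]
  refine (norm_add_le_of_le (norm_sub_le_of_le
    (norm_mul_le_of_le le_rfl e0) (norm_mul_le_of_le le_rfl e1))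
    (norm_mul_le_of_le le_rfl e2)).trans ?_
  have g0 : 0 ≤ ‖2 * Complex.I * κ 1‖ * K0 := by positivity
  have g1 : 0 ≤ ‖2 * κ 1 ^ 2‖ * K1 := by positivity
  have g2 : 0 ≤ ‖Complex.I * κ 1‖ * K2 := by positivity
  generalize ‖2 * Complex.I * κ 1‖ = c0 at *
  generalize ‖2 * κ 1 ^ 2‖ = c1 at *
  generalize ‖Complex.I * κ 1‖ = c2 at *
  nlinarith [mul_nonneg g0 s1, mul_nonneg g0 s2, mul_nonneg g1 s0, mul_nonneg g1 s2,
    mul_nonneg g2 s0, mul_nonneg g2 s1]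

theorem exists_norm_algR2_le (hχ : 0 < χ) {x Q : PerAlg ω} (hx : FDecay χ x)
    (κ : ℕ → ℂ) (v : ℕ → PerAlg ω) (hQv : FDecay χ (Q * v 2)) :
    ∃ K : ℝ, 0 ≤ K ∧ ∀ (b : ℕ → ℝ) (n : ℕ),
      (∀ p, 1 ≤ p → p < n → FBound χ (b p) (v p)) →
      ‖algR2 (prim ω) x κ v (avg ω) Q (n + 3)‖ ≤ K * (shiftConv b 0 n + shiftConv b 1 n) := by
  have hg := hQv.fBounded_mul_prim hχ fBounded_id
  have hgx := hQv.fBounded_mul_prim hχ (hx.fBounded_mul_prim hχ fBounded_id)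
  obtain ⟨K0, hK0, h0⟩ := hgx.norm_sum_avg_le hχ
  obtain ⟨K1, hK1, h1⟩ := hg.norm_sum_avg_le hχ
  refine ⟨‖-2 * κ 1‖ * K0 + ‖Complex.I‖ * K1, by positivity, fun b n hb => ?_⟩
  have e0 := h0 v b 0 n hb
  have e1 := h1 v b 1 n hb
  have s0 := shiftConv_nonneg hb 0
  have s1 := shiftConv_nonneg hb 1
  simp only [zero_add, add_zero, Nat.reduceAdd] at e0 e1
  simp only [algR2, show n + 3 - 4 = n - 1 by omega, show n + 3 - 3 = n by omega,
    show n + 3 - 2 = n + 1 by omega]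
  refine (norm_add_le_of_le (norm_mul_le_of_le le_rfl e0) (norm_mul_le_of_le le_rfl e1)).trans ?_
  have g0 : 0 ≤ ‖-2 * κ 1‖ * K0 := by positivity
  have g1 : 0 ≤ ‖Complex.I‖ * K1 := by positivity
  generalize ‖-2 * κ 1‖ = c0 at *
  generalize ‖Complex.I‖ = c1 at *
  nlinarith [mul_nonneg g0 s1, mul_nonneg g1 s0]

variable {f : ℝ → ℝ} {Q : PerAlg ω} {κ : ℕ → ℂ}

/-- Qualitative decay, with bounds depending on `n` in an uncontrolled way. It supplies the initial
values and the fixed multipliers `v 2` and `v 3` of the uniform estimate. -/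
theorem fDecay_pv (hχ : 0 < χ) (hQ : FDecay χ Q) (hQ' : FDecay χ (cconj Q)) (n : ℕ) :
    FDecay χ (pv κ Q n) := by
  have hone : FDecay χ (1 : PerAlg ω) := ⟨1, FBound.one⟩
  induction n using Nat.strong_induction_on with
  | _ n ih =>
    obtain rfl | rfl | rfl | h3 : n = 0 ∨ n = 1 ∨ n = 2 ∨ 3 ≤ n := by omega
    · rw [pv]
      exact ⟨0, FBound.zero⟩
    · rw [pv]
      exact hQ.smul _
    · rw [pv, sub_eq_add_neg, ← neg_one_smul ℂ (cconj Q * cconj Q)]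
      exact hQ.mul hχ (((((hQ.mul hχ hQ).smul _).add ((hQ'.mul hχ hQ').smul _)).prim hχ).smul _
        |>.add (hone.smul _))
    · rw [pv_eq κ Q n h3]
      obtain ⟨C, hC, hconv⟩ := fBound_conv ω hχ
      choose b hb using ih
      have : FDecay χ (conv (pv κ Q) n) :=
        ⟨_, hconv (pv κ Q) (fun p => if h : p < n then b p h else 0) n fun p _ hp => by
          rw [dif_pos hp]
          exact hb p hp⟩
      exact hQ.mul hχ (((this.prim hχ).smul _).add (hone.smul _))

theorem IsSecularChoice.exists_fBound_pv (hκ : IsSecularChoice f κ) (hχ : 0 < χ)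
    (hQ : (Q : ℝ → ℂ) = q f) (hIII : ConditionIII f) (hdQ : FDecay χ Q)
    (hdx : FDecay χ (Q * Q)) (hdQ' : FDecay χ (cconj Q)) : ∃ K : ℝ, 0 ≤ K ∧
      ∀ (b : ℕ → ℝ) (n : ℕ), 4 ≤ n → (∀ p, 1 ≤ p → p < n → FBound χ (b p) (pv κ Q p)) →
      FBound χ (K * (shiftConv b 0 n + shiftConv b 1 n + shiftConv b 2 n + shiftConv b 3 n))
        (pv κ Q n) := by
  have hd := fDecay_pv (κ := κ) hχ hdQ hdQ'
  obtain ⟨K1, hK1, h1⟩ := exists_norm_algR1_le hχ hdx (hdQ'.mul hχ hdQ') κ (pv κ Q)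
  obtain ⟨K2, hK2, h2⟩ := exists_norm_algR2_le hχ hdx κ (pv κ Q) (hdQ.mul hχ (hd 2))
  obtain ⟨K3, hK3, h3⟩ := (fBounded_id (ω := ω) (χ := χ)).norm_sum_avg_le hχ
  obtain ⟨K4, hK4, h4⟩ := (hdQ'.mul hχ (hd 3)).fBounded_mul hχ
    ((hdx.fBounded_mul_prim hχ fBounded_id).smul Complex.I)
  obtain ⟨K5, hK5, h5⟩ := hdQ.fBounded_mul_prim hχ fBounded_id
  obtain ⟨C, hC, hconv⟩ := fBound_conv ω hχ
  obtain ⟨a, ha⟩ := hdQ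
  have ha0 := ha.nonneg
  refine ⟨K5 * C + ‖-1 / (4 * κ 1 * mean (Q3 f))‖ * (K3 + 2 * K1 + 2 * K2 + 2 * (K4 * C)) * a,
    by positivity, fun b n hn hb => ?_⟩
  -- The constant `κ n` is fixed by the secular condition three orders higher; its sum over `p ∈ [4,
  -- n - 1]` is the shift `j = 3`.
  have hrec := hκ.kappa_rec_eq hQ hIII (n := n + 3) (by omega)
    (fun p h1 _ => (hκ.v_eq_pv hQ hIII p h1).1)
    ((hκ.v_eq_pv hQ hIII _ (by omega)).2 (by omega))
  have e1 := h1 b n hb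
  have e2 := h2 b n hb
  have e3 := h3 (pv κ Q) b 3 n hb
  have econv := hconv (pv κ Q) b n hb
  have e4 := (h4 _ _ econv).norm_avg_le
  have e5 := h5 _ _ econv
  have s0 := shiftConv_nonneg hb 0
  have s1 := shiftConv_nonneg hb 1
  have s2 := shiftConv_nonneg hb 2
  have s3 := shiftConv_nonneg hb 3
  simp only [show n + 3 - 3 = n by omega, show n + 3 - 4 = n - 1 by omega] at hrec
  simp only [Nat.reduceAdd] at e3
  obtain ⟨T, hT⟩ : ∃ T, T = shiftConv b 0 n + shiftConv b 1 n + shiftConv b 2 n +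
    shiftConv b 3 n := ⟨_, rfl⟩
  have hκn : ‖κ n‖ ≤ ‖-1 / (4 * κ 1 * mean (Q3 f))‖ *
      ((K3 + 2 * K1 + 2 * K2 + 2 * (K4 * C)) * T) := by
    rw [hrec]
    refine norm_mul_le_of_le le_rfl ?_
    have two : ‖(2 : ℂ)‖ ≤ 2 := by simp
    refine (norm_add_le_of_le (norm_add_le_of_le (norm_add_le_of_le e3
      (norm_mul_le_of_le two e1)) (norm_mul_le_of_le two e2)) (norm_mul_le_of_le two e4)).trans ?_
    have t0 : K3 * shiftConv b 3 n ≤ K3 * T := by gcongr; linarith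
    have t1 : K1 * (shiftConv b 0 n + shiftConv b 1 n + shiftConv b 2 n) ≤ K1 * T := by
      gcongr; linarith
    have t2 : K2 * (shiftConv b 0 n + shiftConv b 1 n) ≤ K2 * T := by gcongr; linarith
    have t3 : K4 * (C * shiftConv b 0 n) ≤ K4 * C * T := by
      rw [← mul_assoc]; gcongr; linarith
    linarith
  have hv : pv κ Q n = Complex.I • (Q * prim ω (conv (pv κ Q) n)) + κ n • Q := by
    rw [pv_eq κ Q n (by omega)]
    simp only [mul_add, mul_smul_comm, mul_one]
  rw [hv, ← hT]
  refine ((e5.smul Complex.I).add (ha.smul (κ n))).mono ?_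
  rw [Complex.norm_I, one_mul]
  have t4 : K5 * (C * shiftConv b 0 n) ≤ K5 * C * T := by
    rw [← mul_assoc]; gcongr; linarith
  have t5 := mul_le_mul_of_nonneg_right hκn ha0
  linarith

theorem IsSecularChoice.exists_geometric_bound (hκ : IsSecularChoice f κ) (hχ : 0 < χ)
    (hQ : (Q : ℝ → ℂ) = q f) (hIII : ConditionIII f) (hdQ : FDecay χ Q)
    (hdx : FDecay χ (Q * Q)) (hdQ' : FDecay χ (cconj Q)) : ∃ M₀ M₁ : ℝ, 0 < M₀ ∧ 0 < M₁ ∧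
      ∀ n : ℕ, 1 ≤ n → FBound χ (M₀ * M₁ ^ n) (pv κ Q n) := by
  obtain ⟨K, hK, hrec⟩ := hκ.exists_fBound_pv hχ hQ hIII hdQ hdx hdQ'
  have hd := fDecay_pv (κ := κ) hχ hdQ hdQ'
  obtain ⟨B1, h1⟩ := hd 1
  obtain ⟨B2, h2⟩ := hd 2
  obtain ⟨B3, h3⟩ := hd 3
  have n1 := h1.nonneg
  have n2 := h2.nonneg
  have n3 := h3.nonneg
  obtain ⟨b, hb, hbK, M₀, M₁, hM₀, hM₁, hM⟩ :=
    exists_majorant hK (by positivity : 0 ≤ B1 + B2 + B3)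
  refine ⟨M₀, M₁, hM₀, hM₁, fun n hn => FBound.mono ?_ (hM n hn)⟩
  induction n using Nat.strong_induction_on with
  | _ n ih =>
    obtain rfl | rfl | rfl | h4 : n = 1 ∨ n = 2 ∨ n = 3 ∨ 4 ≤ n := by omega
    · exact h1.mono (by linarith [hb 1 (by norm_num) (by norm_num)])
    · exact h2.mono (by linarith [hb 2 (by norm_num) (by norm_num)])
    · exact h3.mono (by linarith [hb 3 (by norm_num) (by norm_num)])
    · exact (hrec b n h4 fun p hp hpn => ih p hpn hp).mono (hbK n h4)

end Bounds

/-! ### Summation of the series and the Riccati equation. -/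

section Series

variable {ω : ℝ} [hω : Fact (0 < ω)] {f : ℝ → ℝ} {κ : ℕ → ℂ}

theorem norm_mul_pow_le {M₀ M₁ W ε : ℝ} {n : ℕ} {z : ℂ} (h : ‖z‖ ≤ M₀ * M₁ ^ n * W) :
    ‖z * (ε : ℂ) ^ n‖ ≤ M₀ * W * (M₁ * |ε|) ^ n := by
  rw [norm_mul, norm_pow, Complex.norm_real, Real.norm_eq_abs, mul_pow]
  calc ‖z‖ * |ε| ^ n ≤ M₀ * M₁ ^ n * W * |ε| ^ n := by gcongr
    _ = _ := by ring

theorem conv_two_pv (κ : ℕ → ℂ) (Q : PerAlg ω) : conv (pv κ Q) 2 = κ 1 ^ 2 • (Q * Q) := by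
  have h : pv κ Q 1 = κ 1 • Q := by rw [pv]
  rw [conv, show Finset.Icc 1 (2 - 1) = {1} by decide, Finset.sum_singleton, h, smul_mul_smul_comm,
    sq]

/-- The Cauchy product of the expansion with itself. -/
theorem sum_antidiagonal_pv (κ : ℕ → ℂ) (Q : PerAlg ω) (ε : ℂ) (t : ℝ) (n : ℕ) :
    ∑ kl ∈ Finset.HasAntidiagonal.antidiagonal n, ((pv κ Q kl.1 : ℝ → ℂ) t * ε ^ kl.1) *
      ((pv κ Q kl.2 : ℝ → ℂ) t * ε ^ kl.2) = ((conv (pv κ Q) n : PerAlg ω) : ℝ → ℂ) t * ε ^ n := by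
  rw [Finset.Nat.sum_antidiagonal_eq_sum_range_succ_mk, conv, PerAlg.sum_apply, Finset.sum_mul]
  have h0 : pv κ Q 0 = 0 := by rw [pv]
  symm
  refine Finset.sum_subset_zero_on_sdiff (fun p hp => ?_) (fun p hp => ?_) (fun p hp => ?_)
  · rw [Finset.mem_Icc] at hp
    rw [Finset.mem_range]
    omega
  · rw [Finset.mem_sdiff, Finset.mem_range, Finset.mem_Icc] at hp
    obtain rfl | h : p = 0 ∨ n - p = 0 := by omega
    · simp [h0]
    · simp [h, h0]
  · rw [Finset.mem_Icc] at hp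
    conv_rhs => rw [mul_mul_mul_comm, ← pow_add, Nat.add_sub_cancel' (by omega : p ≤ n)]
    rw [PerAlg.mul_apply]

/-- The differential equations of the expansion coefficients. -/
theorem hasDerivAt_cconj_mul_pv {Q : PerAlg ω} (hκ : IsSecularChoice f κ)
    (hQ : (Q : ℝ → ℂ) = q f) (hIII : ConditionIII f) (n : ℕ) (t : ℝ) :
    HasDerivAt ((cconj Q * pv κ Q n : PerAlg ω) : ℝ → ℂ)
      (Complex.I * (((conv (pv κ Q) n : PerAlg ω) : ℝ → ℂ) t -
        if n = 2 then ((cconj Q * cconj Q : PerAlg ω) : ℝ → ℂ) t else 0)) t := by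
  have hQQ : cconj Q * Q = 1 := by rw [mul_comm]; exact q_mul_cconj hQ
  have key : ∀ (g : PerAlg ω) (c : ℂ), avg ω g = 0 →
      HasDerivAt ((cconj Q * (Q * (Complex.I • prim ω g + c • 1)) : PerAlg ω) : ℝ → ℂ)
        (Complex.I * (g : ℝ → ℂ) t) t := fun g c hg => by
    rw [← mul_assoc, hQQ, one_mul]
    have := ((hasDerivAt_prim g t).const_mul Complex.I).add_const (c * 1)
    rw [hg, sub_zero] at this
    exact this
  have H := expansion_pv hQ hIII κ
  obtain rfl | rfl | rfl | h3 : n = 0 ∨ n = 1 ∨ n = 2 ∨ 3 ≤ n := by omega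
  · rw [show cconj Q * pv κ Q 0 = 0 by rw [pv, mul_zero], show conv (pv κ Q) 0 = 0 by simp [conv]]
    simp
  · rw [H.one, mul_smul_comm, hQQ, show conv (pv κ Q) 1 = 0 by simp [conv]]
    refine (hasDerivAt_const t (κ 1 * 1)).congr_deriv ?_
    simp
  · rw [H.two, if_pos rfl, ← PerAlg.sub_apply, conv_two_pv]
    exact key _ _ (by rw [map_sub, map_smul, H.mean_x, H.mean_y]; simp)
  · rw [H.step n h3, if_neg (by omega), sub_zero]
    exact key _ _ ((hκ.v_eq_pv hQ hIII n (by omega)).2 h3)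

/-- All products in the convolution share one geometric bound and there are at most `n` of them; the
factor `n` is harmless for summability. -/
theorem norm_conv_apply_le {Q : PerAlg ω} {M₀ M₁ W : ℝ} {t : ℝ}
    (hb : ∀ n, 1 ≤ n → ‖(pv κ Q n : ℝ → ℂ) t‖ ≤ M₀ * M₁ ^ n * W) (h0 : 0 ≤ M₁) (n : ℕ) :
    ‖((conv (pv κ Q) n : PerAlg ω) : ℝ → ℂ) t‖ ≤ (M₀ * W) ^ 2 * (n * M₁ ^ n) := by
  rw [conv, PerAlg.sum_apply]
  have h1 : ∀ p ∈ Finset.Icc 1 (n - 1), ‖((pv κ Q p * pv κ Q (n - p) : PerAlg ω) : ℝ → ℂ) t‖ ≤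
      (M₀ * W) ^ 2 * M₁ ^ n := fun p hp => by
    rw [Finset.mem_Icc] at hp
    rw [PerAlg.mul_apply]
    refine (norm_mul_le_of_le (hb p hp.1) (hb (n - p) (by omega))).trans_eq ?_
    rw [show M₁ ^ n = M₁ ^ p * M₁ ^ (n - p) by rw [← pow_add]; congr 1; omega]
    ring
  refine (norm_sum_le_of_le _ h1).trans ?_
  rw [Finset.sum_const, Nat.card_Icc, nsmul_eq_mul]
  have h2 : ((n - 1 + 1 - 1 : ℕ) : ℝ) ≤ n := by exact_mod_cast (by omega : n - 1 + 1 - 1 ≤ n)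
  calc ((n - 1 + 1 - 1 : ℕ) : ℝ) * ((M₀ * W) ^ 2 * M₁ ^ n)
      ≤ n * ((M₀ * W) ^ 2 * M₁ ^ n) := by gcongr
    _ = _ := by ring

theorem exists_solution {Q : PerAlg ω} (hf : Continuous f) (hκ : IsSecularChoice f κ)
    (hQ : (Q : ℝ → ℂ) = q f) (hIII : ConditionIII f) {M₀ M₁ W : ℝ} (hM₀ : 0 < M₀) (hM₁ : 0 < M₁)
    (hW : 0 ≤ W) (hb : ∀ n, 1 ≤ n → ∀ t, ‖(pv κ Q n : ℝ → ℂ) t‖ ≤ M₀ * M₁ ^ n * W) (ε : ℝ)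
    (hε : |ε| < 1 / M₁) :
    ∃ g : ℝ → ℂ, TendstoUniformly (gPartial f κ ε) g atTop ∧
      ∀ t : ℝ, HasDerivAt g
        (Complex.I * g t ^ 2 + 2 * Complex.I * (f t : ℂ) * g t - Complex.I * (ε : ℂ) ^ 2) t := by
  have hr0 : 0 ≤ M₁ * |ε| := by positivity
  have hr1 : M₁ * |ε| < 1 := by
    rw [lt_div_iff₀ hM₁] at hε
    linarith
  have hpv0 : pv κ Q 0 = 0 := by rw [pv]
  have hQn : ∀ t, ‖(Q : ℝ → ℂ) t‖ = 1 := fun t => by rw [hQ, norm_q]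
  have hb' : ∀ n t, ‖(pv κ Q n : ℝ → ℂ) t * (ε : ℂ) ^ n‖ ≤ M₀ * W * (M₁ * |ε|) ^ n := fun n t => by
    rcases Nat.eq_zero_or_pos n with rfl | hn
    · rw [hpv0]
      simp only [PerAlg.zero_apply, zero_mul, norm_zero]
      positivity
    · exact norm_mul_pow_le (hb n hn t)
  have hs : Summable fun n => M₀ * W * (M₁ * |ε|) ^ n :=
    (summable_geometric_of_lt_one hr0 hr1).mul_left _
  have hunif := tendstoUniformly_tsum_nat hs hb'
  obtain ⟨V, hV⟩ : ∃ V : ℝ → ℂ, V = fun t => ∑' n, (pv κ Q n : ℝ → ℂ) t * (ε : ℂ) ^ n := ⟨_, rfl⟩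
  refine ⟨fun t => (Q : ℝ → ℂ) t * V t, ?_, fun t => ?_⟩
  · rw [Metric.tendstoUniformly_iff] at hunif ⊢
    intro δ hδ
    -- The partial sum up to `N` is the sum over `range (N + 1)`, whose term at `0` vanishes.
    filter_upwards [(tendsto_add_atTop_nat 1).eventually (hunif δ hδ)] with N hN t
    have h1 : gPartial f κ ε N t = (Q : ℝ → ℂ) t *
        ∑ n ∈ Finset.range (N + 1), (pv κ Q n : ℝ → ℂ) t * (ε : ℂ) ^ n := by
      rw [gPartial, hQ, Finset.range_eq_Ico, Finset.sum_eq_sum_Ico_succ_bot (by omega), hpv0,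
        PerAlg.zero_apply, zero_mul, zero_add]
      congr 1
      refine Finset.sum_congr (by ext; simp) fun n hn => ?_
      rw [Finset.mem_Ico] at hn
      rw [(hκ.v_eq_pv hQ hIII n hn.1).1]
    rw [h1, dist_eq_norm, ← mul_sub, norm_mul, hQn, one_mul, ← dist_eq_norm, hV]
    exact hN t
  · have hsn : Summable fun n => ‖(pv κ Q n : ℝ → ℂ) t * (ε : ℂ) ^ n‖ :=
      Summable.of_nonneg_of_le (fun _ => norm_nonneg _) (fun n => hb' n t) hs
    -- the differentiated series
    have hsD : Summable fun n : ℕ => (M₀ * W) ^ 2 * (n * (M₁ * |ε|) ^ n) +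
        if n = 2 then |ε| ^ 2 else 0 := by
      refine Summable.add (Summable.mul_left _ ?_) ?_
      · simpa using summable_pow_mul_geometric_of_norm_lt_one 1
          (by rwa [Real.norm_of_nonneg hr0] : ‖M₁ * |ε|‖ < 1)
      · exact summable_of_ne_finset_zero (s := {2}) fun n hn => by
          rw [if_neg (by simpa using hn)]
    have hconv : ∀ n t, ‖((conv (pv κ Q) n : PerAlg ω) : ℝ → ℂ) t * (ε : ℂ) ^ n‖ ≤
        (M₀ * W) ^ 2 * (n * (M₁ * |ε|) ^ n) := fun n t => by
      rw [norm_mul, norm_pow, Complex.norm_real, Real.norm_eq_abs, mul_pow]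
      calc _ ≤ (M₀ * W) ^ 2 * (n * M₁ ^ n) * |ε| ^ n := by
            gcongr
            exact norm_conv_apply_le (fun n hn => hb n hn t) hM₁.le n
        _ = _ := by ring
    have hif : ∀ n t, ‖(if n = 2 then ((cconj Q * cconj Q : PerAlg ω) : ℝ → ℂ) t else 0) *
        (ε : ℂ) ^ n‖ ≤ if n = 2 then |ε| ^ 2 else 0 := fun n t => by
      split_ifs with h
      · subst h
        rw [PerAlg.mul_apply, norm_mul, norm_mul, cconj_apply, RCLike.norm_conj, hQn, norm_pow,
          Complex.norm_real, Real.norm_eq_abs]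
        simp
      · simp
    have hD := hasDerivAt_tsum (y₀ := t) hsD (fun n τ =>
      (hasDerivAt_cconj_mul_pv hκ hQ hIII n τ).mul_const ((ε : ℂ) ^ n)) (fun n τ => by
        rw [mul_assoc, norm_mul, Complex.norm_I, one_mul, sub_mul]
        exact norm_sub_le_of_le (hconv n τ) (hif n τ))
      (by
        refine Summable.of_norm (hsn.congr fun n => ?_)
        rw [PerAlg.mul_apply, mul_assoc, norm_mul ((cconj Q : ℝ → ℂ) t), cconj_apply, RCLike.norm_conj, hQn, one_mul]) t
    have hVU : V = fun τ => (Q : ℝ → ℂ) τ *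
        ∑' n, ((cconj Q * pv κ Q n : PerAlg ω) : ℝ → ℂ) τ * (ε : ℂ) ^ n := by
      rw [hV]
      funext τ
      rw [← tsum_mul_left]
      congr 1
      funext n
      rw [PerAlg.mul_apply, cconj_apply, hQ]
      linear_combination (-(pv κ Q n : ℝ → ℂ) τ * (ε : ℂ) ^ n) * q_mul_conj f τ
    have hsum : ∑' n, Complex.I * (((conv (pv κ Q) n : PerAlg ω) : ℝ → ℂ) t -
        if n = 2 then ((cconj Q * cconj Q : PerAlg ω) : ℝ → ℂ) t else 0) * (ε : ℂ) ^ n =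
        Complex.I * (V t ^ 2 - ((cconj Q * cconj Q : PerAlg ω) : ℝ → ℂ) t * (ε : ℂ) ^ 2) := by
      have h1 := tsum_mul_tsum_eq_tsum_sum_antidiagonal_of_summable_norm hsn hsn
      simp only [sum_antidiagonal_pv] at h1
      have hs1 : Summable fun n : ℕ => (M₀ * W) ^ 2 * (n * (M₁ * |ε|) ^ n) := by
        refine Summable.mul_left _ ?_
        simpa using summable_pow_mul_geometric_of_norm_lt_one 1
          (by rwa [Real.norm_of_nonneg hr0] : ‖M₁ * |ε|‖ < 1)
      have hs2 : HasSum (fun n : ℕ =>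
          (if n = 2 then ((cconj Q * cconj Q : PerAlg ω) : ℝ → ℂ) t else 0) * (ε : ℂ) ^ n)
          (((cconj Q * cconj Q : PerAlg ω) : ℝ → ℂ) t * (ε : ℂ) ^ 2) := by
        convert hasSum_ite_eq 2 (((cconj Q * cconj Q : PerAlg ω) : ℝ → ℂ) t * (ε : ℂ) ^ 2) using 2
          with n
        split_ifs with h
        · rw [h]
        · rw [zero_mul]
      simp only [mul_assoc, sub_mul]
      rw [tsum_mul_left, (Summable.of_norm_bounded hs1 fun n => hconv n t).tsum_sub hs2.summable,
        hs2.tsum_eq, ← h1, hV, sq (∑' _, _)]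
    -- The solution is `q² U` with `U = ∑ q⁻¹ vₙ εⁿ`. The derivative of `U` does not involve `f`,
    -- and the two factors `q` produce the term `2 i f g`.
    have hfin := (hasDerivAt_q hf t).mul ((hasDerivAt_q hf t).mul hD)
    rw [hsum] at hfin
    have hg : (fun τ => (Q : ℝ → ℂ) τ * V τ) = fun τ => q f τ * (q f τ *
        ∑' n, ((cconj Q * pv κ Q n : PerAlg ω) : ℝ → ℂ) τ * (ε : ℂ) ^ n) := by
      rw [hVU, hQ]
    have hVt := congrFun hVU t
    rw [hg]
    refine hfin.congr_deriv ?_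
    rw [hVt, PerAlg.mul_apply (cconj Q), cconj_apply, hQ, Pi.mul_apply]
    beta_reduce
    generalize ∑' n, ((cconj Q * pv κ Q n : PerAlg ω) : ℝ → ℂ) t * (ε : ℂ) ^ n = U
    have hqq := q_mul_conj f t
    generalize (starRingEnd ℂ) (q f t) = z at *
    linear_combination (-Complex.I * (ε : ℂ) ^ 2 * (q f t * z + 1)) * hqq

end Series

end Secular

end

theorem mainTheorem2
    (f : ℝ → ℝ) (ω : ℝ) (hω : 0 < ω)
    (hf : Continuous f) (hper : Function.Periodic f (2 * Real.pi / ω))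
    (hmean : Secular.mean (fun t => (f t : ℂ)) = 0)
    (hIII : Secular.ConditionIII f)
    (χ 𝒬 : ℝ) (hχ : 0 < χ)
    (hq : ∀ m : ℤ, ‖Secular.coef hω (Secular.q f) m‖ ≤
      𝒬 * (Real.exp (-χ * |(m : ℝ)|) / Secular.bra m ^ 2))
    (hQ0 : ∀ m : ℤ, ‖Secular.coef hω (Secular.Q0 f) m‖ ≤
      𝒬 * (Real.exp (-χ * |(m : ℝ)|) / Secular.bra m ^ 2)) :
    (∃ κ : ℕ → ℂ, Secular.IsSecularChoice f κ) ∧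
    ∀ κ : ℕ → ℂ, Secular.IsSecularChoice f κ →
      (∀ n : ℕ, 1 ≤ n → Function.Periodic (Secular.v f κ n) (2 * Real.pi / ω) ∧
        ∀ t : ℝ, HasSum
          (fun m : ℤ => Secular.coef hω (Secular.v f κ n) m *
            Complex.exp (Complex.I * m * ω * t))
          (Secular.v f κ n t)) ∧
      ∃ M₀ M₁ : ℝ, 0 < M₀ ∧ 0 < M₁ ∧
        (∀ (m : ℤ) (n : ℕ), 1 ≤ n →
          ‖Secular.coef hω (Secular.v f κ n) m‖ ≤
            M₀ * M₁ ^ n * (Real.exp (-χ * |(m : ℝ)|) / Secular.bra m ^ 2)) ∧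
        ∀ ε : ℝ, |ε| < 1 / M₁ →
          ∃ g : ℝ → ℂ,
            TendstoUniformly (Secular.gPartial f κ ε) g atTop ∧
            ∀ t : ℝ, HasDerivAt g
              (Complex.I * g t ^ 2 + 2 * Complex.I * (f t : ℂ) * g t - Complex.I * (ε : ℂ) ^ 2) t := by
  have hωF : Fact (0 < ω) := ⟨hω⟩
  refine ⟨Secular.exists_isSecularChoice f, fun κ hκ => ?_⟩
  obtain ⟨Q, hQ⟩ := Secular.exists_perAlg_q (ω := ω) hf hper hmean
  have hdQ : Secular.FBound χ 𝒬 Q := fun m => by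
    rw [← Secular.coef_eq_fc, hQ]
    exact hq m
  have hdx : Secular.FBound χ 𝒬 (Q * Q) := fun m => by
    rw [← Secular.coef_eq_fc, ← Secular.Q0_eq hQ]
    exact hQ0 m
  obtain ⟨M₀, M₁, hM₀, hM₁, hb⟩ :=
    hκ.exists_geometric_bound hχ hQ hIII ⟨𝒬, hdQ⟩ ⟨𝒬, hdx⟩ ⟨𝒬, hdQ.cconj⟩
  have hv : ∀ n, 1 ≤ n → Secular.v f κ n = (Secular.pv κ Q n : ℝ → ℂ) :=
    fun n hn => (hκ.v_eq_pv hQ hIII n hn).1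
  refine ⟨fun n hn => ?_, M₀, M₁, hM₀, hM₁, fun m n hn => ?_, fun ε hε => ?_⟩
  · rw [hv n hn]
    refine ⟨Secular.PerAlg.periodic _, fun t => ?_⟩
    simp only [Secular.coef_eq_fc]
    exact Secular.hasSum_fc _ ((hb n hn).summable hχ) t
  · rw [hv n hn, Secular.coef_eq_fc]
    exact hb n hn m
  · exact Secular.exists_solution hf hκ hQ hIII hM₀ hM₁
      (tsum_nonneg fun m => (Secular.weight_pos χ m).le)
      (fun n hn t => (hb n hn).norm_apply_le hχ t) ε hε
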